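/- **Definitions.** A *domino set* $\mathcal R=(\mathcal W,\mathcal R_1,\mathcal R_2)$ consists of a non-empty finite set $\mathcal W$ and subsets $\mathcal R_1,\mathcal R_2\subset\mathcal W^2$. For $\Omega\subset\mathbb Z^2$, an *$\mathcal R$-domino function* on $\Omega$ is a function $\mathcal T:\Omega\to\mathcal W$ with $(\mathcal T(s),\mathcal T(s+e_i))\in\mathcal R_i$ whenever $i\in\{1,2\}$ and $s,s+e_i\in\Omega$, where $e_1=(1,0)$, $e_2=(0,1)$; the $\mathcal R$-domino problem is *solvable on $\Omega$* if one exists. Here $\mathbb N=\{0,1,2,\dots\}$. A *Sudoku rule* of width $N$ with non-empty finite digit set $\Sigma$ is a set $\mathcal S$ of functions $\{0,\dots,N-1\}\to\Sigma$, and an *initial condition* of period $q\ge 1$ is a set $\mathcal C\subset(\mathbb Z/q\mathbb Z)\times\Sigma$. The *$(\mathcal S,\mathcal C)$-Sudoku puzzle is solvable* if there is $F:\{0,\dots,N-1\}\times\mathbb Z\to\Sigma$ such that for all $i,j\in\mathbb Z$ the function $n\mapsto F(n,jn+i)$ lies in $\mathcal S$, and such that for every $n\in\{0,\dots,N-1\}$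 there is a permutation $\sigma_n$ of $\mathbb Z/q\mathbb Z$ with $(\sigma_n(m \bmod q),F(n,m))\in\mathcal C$ for all $m\in\mathbb Z$. For a prime $p$ and $x\in\mathbb Z$ let $\nu_p(x)\in\mathbb N\cup\{+\infty\}$ be the $p$-adic valuation ($\nu_p(0)=+\infty$), and let $f_p(x)\in(\mathbb Z/p\mathbb Z)^\times$ be the residue of $x/p^{\nu_p(x)}$ modulo $p$ if $x\neq0$, with $f_p(0)=1$. Let $p_1\ne p_2$ be primes greater than $48$ (for instance $53$ and $59$). Given a domino set $\mathcal R$, put $$N=p_1^2p_2^2,\qquad \Sigma=(\mathbb Z/p_1\mathbb Z)^\times\times(\mathbb Z/p_2\mathbb Z)^\times\times\mathcal W,\qquad q=p_1p_2.$$ The *decorated $p_1\times p_2$-adic Sudoku rule* $\mathcal S^{\mathcal R}$ is the set of all $g=(g_1,g_2,w):\{0,\dots,N-1\}\to\Sigma$ for which there exist integers $a,b$, with $a,b$ not both divisible by $p_1$ and not both divisible by $p_2$, and an $\mathcal R$-domino function $\mathcal T$ on $\{s\in\mathbb Z^2: 0\le s_1\le t_1,\ 0\le s_2\le t_2\}$,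 where $t_l=1$ if $p_l\nmid a$ and $t_l=0$ otherwise, such that for every $n\in\{0,\dots,N-1\}$: * for $l=1,2$, $g_l(n)=f_{p_l}(an+b)$ whenever $\nu_{p_l}(an+b)\le t_l$; * $w(n)=\mathcal T(\nu_{p_1}(an+b),\nu_{p_2}(an+b))$ whenever $\nu_{p_l}(an+b)\le t_l$ for both $l=1,2$. The initial condition $\mathcal C^{\mathcal R}\subset(\mathbb Z/q\mathbb Z)\times\Sigma$, of period $q=p_1p_2$, is the set of all $(a,(b_1,b_2,w))$ such that either $a$ is not coprime to $q$, or $b_1=a \bmod p_1$ and $b_2=a\bmod p_2$. **Theorem.** Let $p_1\neq p_2$ be primes greater than $48$. 1. There is an algorithm (a computable function) which, given any explicit finite description of a domino set $\mathcal R$ (the number of elements of $\mathcal W$, these being labelled $0,1,2,\dots$ in some way, and lists of the elements of $\mathcal R_1$ and $\mathcal R_2$), outputs an explicit finite description of the Sudoku rule $\mathcal S^{\mathcal R}$ and the initial condition $\mathcal C^{\mathcal R}$ (the width, the number of digits, a list of the elements of the rule, the period, and a list of the elements of the initial condition, for some labelling of the digits). 2. For every domino set $\mathcal R$, the $\mathcal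 R$-domino problem is solvable on $\mathbb N^2$ if and only if the $(\mathcal S^{\mathcal R},\mathcal C^{\mathcal R})$-Sudoku puzzle is solvable. In particular, from any domino set $\mathcal R$ one can compute in finite time a Sudoku rule $\mathcal S$ and an initial condition $\mathcal C$ such that the $\mathcal R$-domino problem is solvable on $\mathbb N^2$ if and only if the $(\mathcal S,\mathcal C)$-Sudoku puzzle is solvable. -/

import Mathlib

/-! ### Domino problems -/

/-- A domino set with set of pips `W` (which is required to be finite and non-empty wherever domino
sets are used): the horizontal domino set `R₁` and the vertical domino set `R₂`. -/
structure DominoSet (W : Type*) where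
  R₁ : Set (W × W)
  R₂ : Set (W × W)

/-- `T` is an `R`-domino function on the portion `Ω` of the domino board `ℤ²`. -/
def DominoSet.IsDominoFunction {W : Type*} (R : DominoSet W) (Ω : Set (ℤ × ℤ)) (T : Ω → W) :
    Prop :=
  (∀ (s : ℤ × ℤ) (h : s ∈ Ω) (h' : s + (1, 0) ∈ Ω), (T ⟨s, h⟩, T ⟨s + (1, 0), h'⟩) ∈ R.R₁) ∧
  (∀ (s : ℤ × ℤ) (h : s ∈ Ω) (h' : s + (0, 1) ∈ Ω), (T ⟨s, h⟩, T ⟨s + (0, 1), h'⟩) ∈ R.R₂)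

/-- The `R`-domino problem is solvable on `Ω`. -/
def DominoSet.SolvableOn {W : Type*} (R : DominoSet W) (Ω : Set (ℤ × ℤ)) : Prop :=
  ∃ T : Ω → W, R.IsDominoFunction Ω T

/-- The quadrant `ℕ²`, as a portion of the domino board `ℤ²`. -/
def quadrant : Set (ℤ × ℤ) := {s | 0 ≤ s.1 ∧ 0 ≤ s.2}

/-! ### Sudoku puzzles -/

/-- A Sudoku rule of width `N` and digit set `D`: a collection of functions
`{0, …, N - 1} → D`. -/
abbrev SudokuRule (N : ℕ) (D : Type*) := Set (Fin N → D)

/-- An initial condition of period `q` (where `q ≥ 1`) for the digit set `D`. -/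
abbrev InitialCondition (q : ℕ) (D : Type*) := Set (ZMod q × D)

/-- `F` is a solution, on the board `{0, …, N - 1} × ℤ`, of the Sudoku rule `S`: its restriction to
each non-vertical line `{(n, j n + i)}` lies in `S`. -/
def IsSudokuSolution {N : ℕ} {D : Type*} (S : SudokuRule N D) (F : Fin N × ℤ → D) : Prop :=
  ∀ j i : ℤ, (fun n : Fin N => F (n, j * (n : ℤ) + i)) ∈ S

/-- `F` obeys the initial condition `C`. -/
def ObeysInitial {N q : ℕ} {D : Type*} (C : InitialCondition q D) (F : Fin N × ℤ → D) : Prop :=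
  ∀ n : Fin N, ∃ σ : Equiv.Perm (ZMod q), ∀ m : ℤ, (σ (m : ZMod q), F (n, m)) ∈ C

/-- The `(S, C)`-Sudoku puzzle is solvable. -/
def SudokuSolvable {N q : ℕ} {D : Type*} (S : SudokuRule N D) (C : InitialCondition q D) : Prop :=
  ∃ F : Fin N × ℤ → D, IsSudokuSolution S F ∧ ObeysInitial C F

/-! ### The decorated `p₁ × p₂`-adic Sudoku puzzle -/

/-- The `p`-valuation of an integer, with value `+∞` at `0`. -/
noncomputable def nu (p : ℕ) (x : ℤ) : ℕ∞ := emultiplicity (p : ℤ) x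

theorem div_pow_multiplicity_ne_zero (p : ℕ) [hp : Fact p.Prime] (x : ℤ) (hx : x ≠ 0) :
    ((x / (p : ℤ) ^ multiplicity (p : ℤ) x : ℤ) : ZMod p) ≠ 0 := by
  have hfin : FiniteMultiplicity (p : ℤ) x := by
    rw [Int.finiteMultiplicity_iff]
    exact ⟨by simpa using hp.out.ne_one, hx⟩
  obtain ⟨c, hc, hpc⟩ := hfin.exists_eq_pow_mul_and_not_dvd
  have hp0 : (p : ℤ) ^ multiplicity (p : ℤ) x ≠ 0 :=
    pow_ne_zero _ (by exact_mod_cast hp.out.ne_zero)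
  have hq : x / (p : ℤ) ^ multiplicity (p : ℤ) x = c :=
    Int.ediv_eq_of_eq_mul_right hp0 hc
  rw [hq, Ne, ZMod.intCast_zmod_eq_zero_iff_dvd]
  exact hpc

open Classical in
/-- The last non-zero digit `f_p(x)` of the integer `x` in base `p`, with `f_p(0) = 1`. -/
noncomputable def lastDigit (p : ℕ) [Fact p.Prime] (x : ℤ) : (ZMod p)ˣ :=
  if hx : x = 0 then 1
  else Units.mk0 ((x / (p : ℤ) ^ multiplicity (p : ℤ) x : ℤ) : ZMod p)
    (div_pow_multiplicity_ne_zero p x hx)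

/-- The affine form `n ↦ a n + b` is non-degenerate modulo `p`. -/
def NonDegenerate (p : ℕ) (a b : ℤ) : Prop := ¬ ((a : ZMod p) = 0 ∧ (b : ZMod p) = 0)

open Classical in
/-- `1` if `p` does not divide `a`, and `0` otherwise. -/
noncomputable def tIndex (p : ℕ) (a : ℤ) : ℕ := if nu p a = 0 then 1 else 0

/-- The rectangle `[(0, 0), (t₁, t₂)]` in the domino board, where `t_l = tIndex p_l a`. -/
def tRect (p₁ p₂ : ℕ) (a : ℤ) : Set (ℤ × ℤ) :=
  Set.Icc (0, 0) ((tIndex p₁ a : ℤ), (tIndex p₂ a : ℤ))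

/-- The digit set of the decorated Sudoku. -/
abbrev DecoratedDigit (p₁ p₂ : ℕ) (W : Type*) := (ZMod p₁)ˣ × (ZMod p₂)ˣ × W

/-- The decorated `p₁ × p₂`-adic Sudoku rule, of width `p₁² p₂²`, associated to the
domino set `R`. -/
def decoratedRule (p₁ p₂ : ℕ) [Fact p₁.Prime] [Fact p₂.Prime] {W : Type*} (R : DominoSet W) :
    SudokuRule (p₁ ^ 2 * p₂ ^ 2) (DecoratedDigit p₁ p₂ W) :=
  {g | ∃ a b : ℤ, NonDegenerate p₁ a b ∧ NonDegenerate p₂ a b ∧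
    ∃ T : tRect p₁ p₂ a → W, R.IsDominoFunction (tRect p₁ p₂ a) T ∧
      ∀ n : Fin (p₁ ^ 2 * p₂ ^ 2),
        (nu p₁ (a * (n : ℤ) + b) ≤ (tIndex p₁ a : ℕ∞) →
          (g n).1 = lastDigit p₁ (a * (n : ℤ) + b)) ∧
        (nu p₂ (a * (n : ℤ) + b) ≤ (tIndex p₂ a : ℕ∞) →
          (g n).2.1 = lastDigit p₂ (a * (n : ℤ) + b)) ∧
        ∀ v₁ v₂ : ℕ, nu p₁ (a * (n : ℤ) + b) = v₁ → nu p₂ (a * (n : ℤ) + b) = v₂ →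
          ∀ h : ((v₁ : ℤ), (v₂ : ℤ)) ∈ tRect p₁ p₂ a, (g n).2.2 = T ⟨((v₁ : ℤ), (v₂ : ℤ)), h⟩}

/-- The initial condition, of period `p₁ p₂`, of the decorated `p₁ × p₂`-adic Sudoku: it consists
of all `(a, (b₁, b₂, w))` such that `a` is not coprime to `p₁ p₂`, or `b₁ = a` modulo `p₁` and
`b₂ = a` modulo `p₂`. -/
def decoratedInitial (p₁ p₂ : ℕ) (W : Type*) :
    InitialCondition (p₁ * p₂) (DecoratedDigit p₁ p₂ W) :=
  {x | ¬ Nat.Coprime x.1.val (p₁ * p₂) ∨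
    ((x.2.1 : ZMod p₁) = (x.1.val : ZMod p₁) ∧ (x.2.2.1 : ZMod p₂) = (x.1.val : ZMod p₂))}

/-! ### Explicit finite descriptions, as inputs and outputs of algorithms -/

/-- A description of a domino set: the number of pips (which are labelled `0, …, k - 1`), followed
by lists of the elements of the horizontal and of the vertical domino set. -/
abbrev DominoCode := ℕ × List (ℕ × ℕ) × List (ℕ × ℕ)

/-- A description of a Sudoku rule and of an initial condition: the width, the number of digits
(which are labelled `0, …, d - 1`), a list of the elements of the rule (each one written out as the
list of its values), the period, and a list of the elements of the initial condition. -/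
abbrev SudokuCode := ℕ × ℕ × List (List ℕ) × ℕ × List (ℕ × ℕ)

/-- `c` describes the domino set `R`, for some labelling of the pips. -/
def DescribesDomino {W : Type*} (c : DominoCode) (R : DominoSet W) : Prop :=
  ∃ (k : ℕ) (e : W ≃ Fin k) (L₁ L₂ : List (ℕ × ℕ)), c = (k, L₁, L₂) ∧
    (∀ x, x ∈ L₁ ↔ ∃ y ∈ R.R₁, x = ((e y.1 : ℕ), (e y.2 : ℕ))) ∧
    (∀ x, x ∈ L₂ ↔ ∃ y ∈ R.R₂, x = ((e y.1 : ℕ), (e y.2 : ℕ)))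

/-- `c` describes the Sudoku rule `S` and the initial condition `C`, for some labelling of the
digits. -/
def DescribesSudoku {N q : ℕ} {D : Type*} (c : SudokuCode) (S : SudokuRule N D)
    (C : InitialCondition q D) : Prop :=
  ∃ (d : ℕ) (e : D ≃ Fin d) (LS : List (List ℕ)) (LC : List (ℕ × ℕ)), c = (N, d, LS, q, LC) ∧
    (∀ l, l ∈ LS ↔ ∃ g ∈ S, l = List.ofFn (fun n : Fin N => (e (g n) : ℕ))) ∧
    (∀ x, x ∈ LC ↔ ∃ y ∈ C, x = (y.1.val, (e y.2 : ℕ)))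

/-!
The hard direction of the equivalence is that a Sudoku solution yields a domino function. Fix one of
the primes, `p`, and keep only the corresponding digits `G n m : ZMod p`. Along each line these
agree with an affine function `a n + b` modulo `p` away from its zeros and, if `p ∤ a`, with
`(a n + b) / p` at the zeros modulo `p` that are not zeros modulo `p ^ 2`. The claim is that for
every `r` there are integers `A`, `C` such that `G n m` is a constant `B ≠ 0` times the last
non-zero digit of `m + A n + C`, unless `p ^ (r + 1)` divides this integer (`AdicStructure`).

* For `r = 0` (`IsAdicSolution.exists_adicStructure_zero`) the initial condition is used: outside
  few residue classes, each column is a balanced function on `ZMod (p₁ * p₂)`. Averaging gives three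
  consecutive columns in which few lines have a zero. The affine relation along the other lines says
  that the three functions satisfy `f x + g z = h (x + z)` for more than five sixths of the pairs,
  so that they nearly are translates of one homomorphism (`exists_hom_of_approx_additive`). This is
  where the primes have to be large: those greater than `48` are `53` or at least `59`, and they are
  distinct. The columns nearby are then determined exactly, by lines that meet the three columns at
  typical points, and these columns determine all others.
* The step from `r` to `r + 1` (`AdicStructure.succ`) does not use the initial condition. On the
  lattice `p ^ (r + 1) ∣ m + A n + C`, transverse lines have known slope modulo `p`, and the digits
  of order two along them show that the next digit is `B y` plus a constant in each progression of
  columns with step `p`, where `y` is the height in the lattice. The lines contained in the lattice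
  show that this constant is affine in the column.

Given this structure for both primes up to order `K`, with common `A` and `C` by the Chinese
remainder theorem, the decoration is constant along the line `m + A n + C = p₁ ^ r₁ * p₂ ^ r₂`, and
the line `m + A n + C = p₁ ^ r₁ * p₂ ^ r₂ * n`, at `n = 1, p₁, p₂`, relates the pip of `(r₁, r₂)` to
those of `(r₁ + 1, r₂)` and `(r₁, r₂ + 1)` (`exists_domino_square`). A limit along an ultrafilter
passes from squares to the quadrant.

Conversely, a domino function `T` gives the solution whose digits at `(n, m)` are the last non-zero
digits of `m`, decorated by `T` at the valuations of `m` (`isSudokuSolution_adicBoard`).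

For the algorithm, the primes are fixed, so that an affine form constrains a line through one of
finitely many patterns (`LinePattern`), and membership in the rule is a bounded search over the lists of
digits, the patterns and four pips (`exists_primrec_rule`).
-/

/-! ### Digits -/

theorem Int.exists_eq_pow_mul_of_prime {p : ℕ} (hp : p.Prime) {x : ℤ} (hx : x ≠ 0) :
    ∃ (v : ℕ) (e : ℤ), x = (p : ℤ) ^ v * e ∧ ¬ (p : ℤ) ∣ e := by
  have hfin : FiniteMultiplicity (p : ℤ) x := by
    rw [Int.finiteMultiplicity_iff]
    exact ⟨by simpa using hp.ne_one, hx⟩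
  obtain ⟨c, hc, hpc⟩ := hfin.exists_eq_pow_mul_and_not_dvd
  exact ⟨_, c, hc, hpc⟩

theorem nu_pow_mul {p : ℕ} (hp : p.Prime) (v : ℕ) {e : ℤ} (he : ¬ (p : ℤ) ∣ e) :
    nu p ((p : ℤ) ^ v * e) = v := by
  unfold nu
  rw [emultiplicity_eq_coe]
  refine ⟨Dvd.intro _ rfl, fun h => he ?_⟩
  rw [pow_succ] at h
  exact Int.dvd_of_mul_dvd_mul_left (pow_ne_zero _ (by exact_mod_cast hp.ne_zero)) h

theorem nu_eq_zero {p : ℕ} {e : ℤ} (he : ¬ (p : ℤ) ∣ e) : nu p e = 0 := by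
  unfold nu
  exact emultiplicity_eq_zero.2 he

theorem nu_zero (p : ℕ) : nu p 0 = ⊤ := by
  unfold nu
  exact emultiplicity_zero _

theorem nu_eq_coe {p : ℕ} {x : ℤ} {v : ℕ} (h : nu p x = v) :
    ∃ e : ℤ, x = (p : ℤ) ^ v * e ∧ ¬ (p : ℤ) ∣ e := by
  unfold nu at h
  rw [emultiplicity_eq_coe] at h
  obtain ⟨e, he⟩ := h.1
  refine ⟨e, he, fun ⟨d, hd⟩ => h.2 ⟨d, ?_⟩⟩
  rw [he, hd]; ring

theorem intCast_ne_zero_iff {p : ℕ} {e : ℤ} : (e : ZMod p) ≠ 0 ↔ ¬ (p : ℤ) ∣ e := by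
  rw [Ne, ZMod.intCast_zmod_eq_zero_iff_dvd]

theorem lastDigit_pow_mul (p : ℕ) [hp : Fact p.Prime] (v : ℕ) {e : ℤ} (he : ¬ (p : ℤ) ∣ e) :
    (lastDigit p ((p : ℤ) ^ v * e) : ZMod p) = e := by
  have hp0 : (p : ℤ) ≠ 0 := by exact_mod_cast hp.out.ne_zero
  have he0 : e ≠ 0 := by rintro rfl; simp at he
  have hx : (p : ℤ) ^ v * e ≠ 0 := mul_ne_zero (pow_ne_zero _ hp0) he0
  have hm : multiplicity (p : ℤ) ((p : ℤ) ^ v * e) = v := by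
    apply multiplicity_eq_of_emultiplicity_eq_some
    exact nu_pow_mul hp.out v he
  unfold lastDigit
  rw [dif_neg hx, Units.val_mk0, hm, Int.mul_ediv_cancel_left _ (pow_ne_zero _ hp0)]

theorem lastDigit_of_not_dvd (p : ℕ) [hp : Fact p.Prime] {e : ℤ} (he : ¬ (p : ℤ) ∣ e) :
    (lastDigit p e : ZMod p) = e := by
  simpa using lastDigit_pow_mul p 0 he

theorem tIndex_of_not_dvd {p : ℕ} {a : ℤ} (h : ¬ (p : ℤ) ∣ a) : tIndex p a = 1 := by
  unfold tIndex
  rw [if_pos (nu_eq_zero h)]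

theorem tIndex_of_dvd {p : ℕ} {a : ℤ} (h : (p : ℤ) ∣ a) : tIndex p a = 0 := by
  unfold tIndex
  rw [if_neg]
  unfold nu
  rw [emultiplicity_eq_zero]
  exact not_not.2 h

/-! ### Affine functions modulo a prime -/

/-- Two affine functions over a field agree as soon as the second one, whenever the first one is
non-zero, agrees with it on three points: a non-zero affine function has at most one zero. -/
theorem affine_eq_of_three {K : Type*} [Field K] {a b c d : K} (S : Finset K) (hS : 3 ≤ S.card)
    (hab : ¬ (a = 0 ∧ b = 0)) (h : ∀ x ∈ S, a * x + b ≠ 0 → c * x + d = a * x + b) :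
    c = a ∧ d = b := by
  classical
  have hz : (S.filter fun x => a * x + b = 0).card ≤ 1 := by
    rw [Finset.card_le_one]
    intro x hx y hy
    simp only [Finset.mem_filter] at hx hy
    by_cases ha : a = 0
    · exact absurd ⟨ha, by simpa [ha] using hx.2⟩ hab
    · exact mul_left_cancel₀ ha (add_right_cancel (hx.2.trans hy.2.symm))
  have hsum := S.card_filter_add_card_filter_not (fun x => a * x + b = 0)
  have h1 : 1 < (S.filter fun x => ¬ a * x + b = 0).card := by omega
  obtain ⟨x, hx, y, hy, hxy⟩ := Finset.one_lt_card.1 h1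
  simp only [Finset.mem_filter] at hx hy
  have ex := h x hx.1 hx.2
  have ey := h y hy.1 hy.2
  have hca : (c - a) * (x - y) = 0 := by linear_combination ex - ey
  have hc : c = a := by
    rcases mul_eq_zero.1 hca with h | h
    · exact sub_eq_zero.1 h
    · exact absurd (sub_eq_zero.1 h) hxy
  subst hc
  exact ⟨rfl, add_left_cancel ex⟩

/-- Two non-zero affine functions over a field are equal if they agree, on four points, wherever
they are both non-zero. -/
theorem affine_eq_of_four {K : Type*} [Field K] {a b c d : K} (S : Finset K) (hS : 4 ≤ S.card)
    (hab : ¬ (a = 0 ∧ b = 0)) (hcd : ¬ (c = 0 ∧ d = 0))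
    (h : ∀ x ∈ S, a * x + b ≠ 0 → c * x + d ≠ 0 → c * x + d = a * x + b) :
    c = a ∧ d = b := by
  classical
  have hz : (S.filter fun x => c * x + d = 0).card ≤ 1 := by
    rw [Finset.card_le_one]
    intro x hx y hy
    simp only [Finset.mem_filter] at hx hy
    by_cases ha : c = 0
    · exact absurd ⟨ha, by simpa [ha] using hx.2⟩ hcd
    · exact mul_left_cancel₀ ha (add_right_cancel (hx.2.trans hy.2.symm))
  have hsum := S.card_filter_add_card_filter_not (fun x => c * x + d = 0)
  refine affine_eq_of_three (S.filter fun x => ¬ c * x + d = 0) (by omega) hab ?_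
  intro x hx hx0
  simp only [Finset.mem_filter] at hx
  exact h x hx.1 hx0 hx.2

/-- The residues of the integers of an interval of length at most `p` are distinct. -/
theorem card_image_natCast_Ico {p s k : ℕ} (hk : k ≤ p) :
    ((Finset.Ico s (s + k)).image (fun n : ℕ => (n : ZMod p))).card = k := by
  rw [Finset.card_image_of_injOn]
  · simp
  · intro x hx y hy hxy
    simp only [Finset.coe_Ico, Set.mem_Ico] at hx hy
    have h := (ZMod.natCast_eq_natCast_iff _ _ _).1 hxy
    rcases le_total x y with hle | hle
    · have hd := (Nat.modEq_iff_dvd' hle).1 h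
      have := Nat.eq_zero_of_dvd_of_lt hd (by omega)
      omega
    · have hd := (Nat.modEq_iff_dvd' hle).1 h.symm
      have := Nat.eq_zero_of_dvd_of_lt hd (by omega)
      omega

/-! ### The first two digits along a line -/

/-- The digits `g 0, …, g (N - 1)` agree with the last non-zero digits of the integers `a n + b`
to second order: at the `n` with `p ∤ a n + b` and, if `p ∤ a`, also at the `n` with
`p² ∤ a n + b`. -/
structure AgreesWithLine (p N : ℕ) (g : ℕ → ZMod p) (a b : ℤ) : Prop where
  nondeg : ¬ ((a : ZMod p) = 0 ∧ (b : ZMod p) = 0)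
  unit : ∀ n < N, ((a : ZMod p) * n + b ≠ 0) → g n = a * n + b
  prime : (a : ZMod p) ≠ 0 → ∀ n < N, ∀ e : ℤ, a * n + b = p * e → (e : ZMod p) ≠ 0 → g n = e

theorem agreesWithLine_of_lastDigit {p N : ℕ} [hp : Fact p.Prime] {g : ℕ → ZMod p} {a b : ℤ}
    (hab : NonDegenerate p a b)
    (h : ∀ n < N, nu p (a * (n : ℤ) + b) ≤ (tIndex p a : ℕ∞) →
      g n = (lastDigit p (a * (n : ℤ) + b) : ZMod p)) : AgreesWithLine p N g a b := by
  refine ⟨hab, fun n hn h0 => ?_, fun ha n hn e he he0 => ?_⟩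
  · have h1 : ¬ (p : ℤ) ∣ a * n + b := by
      rw [← intCast_ne_zero_iff]; push_cast; exact h0
    rw [h n hn (by rw [nu_eq_zero h1]; exact zero_le), lastDigit_of_not_dvd p h1]
    push_cast; rfl
  · rw [intCast_ne_zero_iff] at he0 ha
    have h2 := nu_pow_mul hp.out 1 he0
    have h3 := lastDigit_pow_mul p 1 he0
    rw [pow_one, ← he] at h2 h3
    rw [h n hn (by rw [h2, tIndex_of_not_dvd ha]), h3]

/-- Along a line, the digits determine the affine form modulo `p`. -/
theorem AgreesWithLine.eq_of_agree {p N : ℕ} [hp : Fact p.Prime] {g : ℕ → ZMod p} {a b : ℤ}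
    (h : AgreesWithLine p N g a b) (s : ℕ) (hs : s + 4 ≤ N) (hp4 : 4 ≤ p) {c d : ZMod p}
    (hcd : ¬ (c = 0 ∧ d = 0))
    (hg : ∀ n, s ≤ n → n < s + 4 → c * n + d ≠ 0 → g n = c * n + d) :
    (a : ZMod p) = c ∧ (b : ZMod p) = d := by
  refine affine_eq_of_four _ (card_image_natCast_Ico (s := s) hp4).ge hcd h.nondeg ?_
  intro x hx h0 h1
  obtain ⟨n, hn, rfl⟩ := Finset.mem_image.1 hx
  rw [Finset.mem_Ico] at hn
  rw [← h.unit n (by omega) h1, hg n hn.1 hn.2 h0]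

/-! ### Lifting the structure of a solution from one power of `p` to the next -/

/-- The columns of digits `G n : ℤ → ZMod p`, for `n < N`, solve the `p`-adic Sudoku: along each
non-vertical line, the digits agree with an affine form to second order. -/
structure IsAdicSolution (p N : ℕ) (G : ℕ → ℤ → ZMod p) : Prop where
  ne_zero : ∀ n < N, ∀ m, G n m ≠ 0
  line : ∀ j i : ℤ, ∃ a b : ℤ, AgreesWithLine p N (fun n => G n (j * n + i)) a b

/-- The digit `G n m` is `B` times the last non-zero digit of `m + A n + C`, as long as
`p ^ (r + 1)` does not divide this integer. -/
def AdicStructure (p N : ℕ) (G : ℕ → ℤ → ZMod p) (B : ZMod p) (r : ℕ) (A C : ℤ) : Prop :=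
  ∀ n < N, ∀ m : ℤ, ∀ v ≤ r, ∀ e : ℤ, m + A * n + C = (p : ℤ) ^ v * e → (e : ZMod p) ≠ 0 →
    G n m = B * e

/-- Only the residues of `A` and `C` modulo `p ^ (r + 1)` matter. -/
theorem AdicStructure.congr {p N : ℕ} {G : ℕ → ℤ → ZMod p} {B : ZMod p} {r : ℕ} {A C : ℤ}
    (h : AdicStructure p N G B r A C) {A' C' : ℤ} (hA : A' ≡ A [ZMOD (p : ℤ) ^ (r + 1)])
    (hC : C' ≡ C [ZMOD (p : ℤ) ^ (r + 1)]) : AdicStructure p N G B r A' C' := by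
  intro n hn m v hv e he he0
  obtain ⟨x, hx⟩ := hA.dvd
  obtain ⟨y, hy⟩ := hC.dvd
  have hpow : (p : ℤ) ^ (r + 1) = (p : ℤ) ^ v * ((p : ℤ) * (p : ℤ) ^ (r - v)) := by
    rw [← pow_succ', ← pow_add]; congr 1; omega
  have key : ((e + (p : ℤ) * (p : ℤ) ^ (r - v) * (x * n + y) : ℤ) : ZMod p) = e := by
    push_cast; simp
  rw [h n hn m v hv (e + (p : ℤ) * (p : ℤ) ^ (r - v) * (x * n + y)) ?_ (by rwa [key]), key]
  linear_combination he + n * hx + hy + (x * n + y) * hpow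

/-- Along a progression of columns with step `p`, on the lattice `p ^ (r + 1) ∣ m + A n + C`, the
next digit is affine with slope prescribed by `B`, wherever this affine function is non-zero: on a
line transverse to the lattice, the first-order digits give the slope and the second-order digits
are those on the lattice. -/
theorem AdicStructure.exists_const {p N : ℕ} [hp : Fact p.Prime] {G : ℕ → ℤ → ZMod p}
    (hG : IsAdicSolution p N G) (hp4 : 4 ≤ p) (hN : p + 4 ≤ N) {B : ZMod p} (hB : B ≠ 0) {r : ℕ}
    {A C : ℤ} (h : AdicStructure p N G B r A C) (n₀ : ℕ) (y₀ s : ℤ) (hs : (s : ZMod p) ≠ 0) :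
    ∃ γ : ZMod p, ∀ k : ℕ, n₀ + p * k < N → B * (y₀ + s * k) + γ ≠ 0 →
      G (n₀ + p * k) ((p : ℤ) ^ (r + 1) * (y₀ + s * k) - A * ((n₀ + p * k : ℕ) : ℤ) - C) =
        B * (y₀ + s * k) + γ := by
  obtain ⟨a, b, hab⟩ := hG.line ((p : ℤ) ^ r * s - A) ((p : ℤ) ^ r * (p * y₀ - s * n₀) - C)
  have hst := hab.eq_of_agree 0 (by omega) hp4 (c := B * s) (d := -(B * s * n₀))
    (fun h0 => mul_ne_zero hB hs h0.1) ?_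
  · have ha : (a : ZMod p) ≠ 0 := by rw [hst.1]; exact mul_ne_zero hB hs
    have hdvd : (p : ℤ) ∣ a * n₀ + b := by
      rw [← ZMod.intCast_zmod_eq_zero_iff_dvd]
      push_cast
      rw [hst.1, hst.2]; ring
    obtain ⟨e₀, he₀⟩ := hdvd
    refine ⟨e₀ - B * y₀, fun k hk hne => ?_⟩
    have hval : ((e₀ + a * k : ℤ) : ZMod p) = B * (y₀ + s * k) + (e₀ - B * y₀) := by
      push_cast; rw [hst.1]; ring
    have := hab.prime ha (n₀ + p * k) hk (e₀ + a * k) (by push_cast; linear_combination he₀)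
      (by rwa [hval])
    rw [← hval, ← this]
    congr 1
    push_cast; ring
  · intro n _ hn h0
    have hval : ((s * (n - n₀) + p * y₀ : ℤ) : ZMod p) = s * (n - n₀) := by
      push_cast; simp
    have h1 : B * s * n + -(B * s * n₀) = B * (s * (n - n₀)) := by ring
    rw [h1, ← hval]
    refine h n (by omega) _ r le_rfl _ (by ring) ?_
    rw [hval]
    rw [h1] at h0
    exact right_ne_zero_of_mul h0

/-- Some residue avoids four given ones. -/
theorem exists_lt_natCast_ne {p : ℕ} [hp : Fact p.Prime] (hp4 : 4 < p) (a b c d : ZMod p) :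
    ∃ k < p, (k : ZMod p) ≠ a ∧ (k : ZMod p) ≠ b ∧ (k : ZMod p) ≠ c ∧ (k : ZMod p) ≠ d := by
  classical
  have hcard : ({a, b, c, d} : Finset (ZMod p)).card < (Finset.univ : Finset (ZMod p)).card := by
    rw [Finset.card_univ, ZMod.card]
    exact Finset.card_le_four.trans_lt hp4
  obtain ⟨x, -, hx⟩ := Finset.exists_mem_notMem_of_card_lt_card hcard
  refine ⟨x.val, ZMod.val_lt x, ?_⟩
  rw [ZMod.natCast_zmod_val]
  simpa using hx

/-- In a progression of columns with step `p`, the next digit on the lattice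
`p ^ (r + 1) ∣ m + A n + C` is the same affine function of the height in all columns, up to
zeros. Two parallel lines of slope `1` have the same constant because a third line meets them, in
neighbouring columns, at points that are zeros for none of them. -/
theorem AdicStructure.exists_column_const {p N : ℕ} [hp : Fact p.Prime] {G : ℕ → ℤ → ZMod p}
    (hG : IsAdicSolution p N G) (hp4 : 4 < p) (hN : 2 * p + p * p ≤ N) {B : ZMod p} (hB : B ≠ 0)
    {r : ℕ} {A C : ℤ} (h : AdicStructure p N G B r A C) (n₀ : ℕ) (hn₀ : n₀ < p) :
    ∃ γ : ZMod p, ∀ k : ℕ, n₀ + p * k < N → ∀ y : ℤ, B * y + γ ≠ 0 →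
      G (n₀ + p * k) ((p : ℤ) ^ (r + 1) * y - A * ((n₀ + p * k : ℕ) : ℤ) - C) = B * y + γ := by
  have hN4 : p + 4 ≤ N := by omega
  have hex := h.exists_const hG (by omega) hN4 hB n₀
  choose γ hγ using fun y₀ : ℤ => hex y₀ 1 (by simp)
  -- Two lines of slope `1` are compared when the crossing line is not horizontal modulo `p`.
  have hcmp : ∀ i i' : ℤ, ((i' - i + 1 : ℤ) : ZMod p) ≠ 0 → γ i = γ i' := by
    intro i i' hs
    by_contra hne
    obtain ⟨k, hk, h1, h2, h3, h4⟩ := exists_lt_natCast_ne hp4 (-(γ i) / B - i)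
      (-(γ i') / B - i) (-(γ i) / B - i' - 1) (-(γ i') / B - i' - 1)
    have hk1 : n₀ + p * (k + 1) < N := by nlinarith
    have hk0 : n₀ + p * k < N := by nlinarith
    obtain ⟨δ, hδ⟩ := hex (i + k - (i' - i + 1) * k) (i' - i + 1) hs
    have e1 : ((i + k - (i' - i + 1) * k : ℤ) : ZMod p) + ((i' - i + 1 : ℤ) : ZMod p) * (k : ℕ)
        = i + k := by push_cast; ring
    have e2 : ((i + k - (i' - i + 1) * k : ℤ) : ZMod p) + ((i' - i + 1 : ℤ) : ZMod p) *
        ((k + 1 : ℕ) : ZMod p) = i' + k + 1 := by push_cast; ring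
    have g1 := hγ i k hk0
    have g2 := hγ i' (k + 1) hk1
    have d1 := hδ k hk0
    have d2 := hδ (k + 1) hk1
    rw [e1] at d1
    rw [e2] at d2
    have z1 : B * (i + k) + γ i ≠ 0 := fun h0 => h1 (by field_simp; linear_combination h0)
    have z2 : B * (i + k) + γ i' ≠ 0 := fun h0 => h2 (by field_simp; linear_combination h0)
    have z3 : B * (i' + k + 1) + γ i ≠ 0 := fun h0 => h3 (by field_simp; linear_combination h0)
    have z4 : B * (i' + k + 1) + γ i' ≠ 0 := fun h0 => h4 (by field_simp; linear_combination h0)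
    push_cast at g1 g2 d1 d2
    have g1 := g1 (by simpa using z1)
    have g2 := g2 (by convert z4 using 2; ring)
    have w1 : B * (i + k) + δ ≠ 0 → γ i = δ := by
      intro h0
      have h5 := d1 h0
      rw [show i + (k : ℤ) - (i' - i + 1) * k + (i' - i + 1) * k = i + 1 * k by ring, g1] at h5
      linear_combination h5
    have w2 : B * (i' + k + 1) + δ ≠ 0 → γ i' = δ := by
      intro h0
      have h5 := d2 h0
      rw [show i + (k : ℤ) - (i' - i + 1) * k + (i' - i + 1) * (k + 1) = i' + 1 * (k + 1) by ring,
        g2] at h5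
      linear_combination h5
    have w3 : B * (i + k) + δ = 0 := by
      by_contra h0
      have h6 := w1 h0
      rw [← h6] at w2
      exact hne (w2 z3).symm
    have w4 : B * (i' + k + 1) + δ = 0 := by
      by_contra h0
      have h6 := w2 h0
      rw [← h6] at w3
      exact z2 w3
    apply hs
    push_cast
    exact (mul_eq_zero.1 (show B * ((i' : ZMod p) - i + 1) = 0 by
      linear_combination w4 - w3)).resolve_left hB
  have hall : ∀ i i', γ i = γ i' := by
    intro i i'
    by_cases hs : ((i' - i + 1 : ℤ) : ZMod p) = 0
    · refine (hcmp i' i fun h0 => ?_).symm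
      have h2 : ((2 : ℕ) : ZMod p) = 0 := by
        push_cast at hs h0 ⊢; linear_combination hs + h0
      rw [ZMod.natCast_eq_zero_iff] at h2
      exact absurd (Nat.le_of_dvd two_pos h2) (by omega)
    · exact hcmp i i' hs
  refine ⟨γ 0, fun k hk y hy => ?_⟩
  have e1 : ((y - k : ℤ) : ZMod p) + ((1 : ℤ) : ZMod p) * (k : ℕ) = y := by push_cast; ring
  have := hγ (y - k) k hk
  rw [e1, hall _ 0] at this
  rw [← this hy]
  congr 1
  push_cast; ring

/-- If the digits of an adic solution on the lattice `p ^ (r + 1) ∣ m + A n + C` are affine in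
each column `n`, with constants depending on `n` modulo `p`, then these constants are affine in
`n`: comparing the columns along horizontal lines shows this first for almost all, then for all
columns. -/
theorem IsAdicSolution.column_const_affine {p N : ℕ} [hp : Fact p.Prime] {G : ℕ → ℤ → ZMod p}
    (hG : IsAdicSolution p N G) (hp6 : 6 ≤ p) (hN : p ≤ N) {B : ZMod p} (hB : B ≠ 0)
    (M A C : ℤ) (c : ZMod p → ZMod p)
    (hc : ∀ n < N, ∀ y : ℤ, B * y + c n ≠ 0 → G n (M * y - A * n - C) = B * y + c n) :
    ∃ a d : ZMod p, ∀ x, c x = a * x + d := by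
  classical
  have hline : ∀ y : ℤ, ∃ a b : ZMod p, ¬ (a = 0 ∧ b = 0) ∧ ∀ x : ZMod p, a * x + b ≠ 0 →
      B * y + c x ≠ 0 → a * x + b = B * y + c x := by
    intro y
    obtain ⟨a, b, hab⟩ := hG.line (-A) (M * y - C)
    refine ⟨a, b, hab.nondeg, fun x h0 h1 => ?_⟩
    have hx := ZMod.natCast_zmod_val x
    have hlt : x.val < N := (ZMod.val_lt x).trans_le hN
    have h2 := hab.unit x.val hlt (by rwa [hx])
    have h3 := hc x.val hlt y (by rwa [hx])
    rw [hx] at h2 h3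
    rw [← h2, ← h3]
    congr 1; ring
  -- A height at which at most one of the columns has a zero.
  obtain ⟨v, -, hv⟩ := Finset.exists_card_fiber_le_of_card_le_mul
    (s := (Finset.univ : Finset (ZMod p))) (t := (Finset.univ : Finset (ZMod p)))
    (f := fun x => -c x / B) (n := 1) ⟨0, Finset.mem_univ _⟩ (by simp)
  obtain ⟨a, b, hab, hl⟩ := hline v.val
  have hvv : ((v.val : ℤ) : ZMod p) = v := by simp
  rw [hvv] at hl
  set β : ZMod p → ZMod p := fun x => a * x + (b - B * v) with hβ
  have hD : (Finset.univ.filter fun x => c x ≠ β x).card ≤ 2 := by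
    have hz : (Finset.univ.filter fun x => a * x + b = 0).card ≤ 1 := by
      rw [Finset.card_le_one]
      intro x hx y hy
      simp only [Finset.mem_filter] at hx hy
      by_cases ha : a = 0
      · exact absurd ⟨ha, by simpa [ha] using hx.2⟩ hab
      · exact mul_left_cancel₀ ha (add_right_cancel (hx.2.trans hy.2.symm))
    refine (Finset.card_le_card (t := (Finset.univ.filter fun x => -c x / B = v) ∪
      (Finset.univ.filter fun x => a * x + b = 0)) ?_).trans
      ((Finset.card_union_le _ _).trans (by omega))
    intro x hx
    simp only [Finset.mem_filter, Finset.mem_univ, true_and, Finset.mem_union] at hx ⊢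
    by_contra hcon
    push Not at hcon
    refine hx ?_
    have := hl x hcon.2 fun h0 => hcon.1 (by field_simp; linear_combination -h0)
    rw [hβ]
    linear_combination -this
  refine ⟨a, b - B * v, fun x₀ => ?_⟩
  obtain ⟨k, -, h1, h2, -, -⟩ := exists_lt_natCast_ne (p := p) (by omega) (-c x₀ / B)
    (-β x₀ / B) 0 0
  have h1 : B * k + c x₀ ≠ 0 := fun h0 => h1 (by field_simp; linear_combination h0)
  have h2 : B * k + β x₀ ≠ 0 := fun h0 => h2 (by field_simp; linear_combination h0)
  obtain ⟨a', b', hab', hl'⟩ := hline k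
  rw [Int.cast_natCast] at hl'
  have heq := affine_eq_of_four (a := a') (b := b') (c := a) (d := B * k + (b - B * v))
    (Finset.univ.filter fun x => ¬ c x ≠ β x) ?_ hab' ?_ ?_
  · rw [← heq.1, ← heq.2] at hl'
    have hval : a * x₀ + (B * k + (b - B * v)) = B * k + β x₀ := by rw [hβ]; ring
    have := hl' x₀ (by rwa [hval]) h1
    linear_combination -this
  · have := (Finset.univ : Finset (ZMod p)).card_filter_add_card_filter_not
      (fun x => c x ≠ β x)
    rw [Finset.card_univ, ZMod.card] at this
    omega
  · rintro ⟨ha, hb⟩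
    apply h2
    rw [hβ]
    linear_combination x₀ * ha + hb
  · intro x hx h0 h3
    simp only [Finset.mem_filter, Finset.mem_univ, true_and, not_not] at hx
    have hval : a * x + (B * k + (b - B * v)) = B * k + c x := by rw [hx, hβ]; ring
    rw [hval] at h3 ⊢
    exact (hl' x h0 h3).symm

/-- The structure of an adic solution up to order `r` extends to order `r + 1`. -/
theorem AdicStructure.succ {p N : ℕ} [hp : Fact p.Prime] {G : ℕ → ℤ → ZMod p}
    (hG : IsAdicSolution p N G) (hp6 : 6 ≤ p) (hN : 2 * p + p * p ≤ N) {B : ZMod p} (hB : B ≠ 0)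
    {r : ℕ} {A C : ℤ} (h : AdicStructure p N G B r A C) :
    ∃ A' C' : ℤ, AdicStructure p N G B (r + 1) A' C' := by
  choose! γ hγ using h.exists_column_const hG (by omega) hN hB
  have hc : ∀ n < N, ∀ y : ℤ, B * y + γ (n : ZMod p).val ≠ 0 →
      G n ((p : ℤ) ^ (r + 1) * y - A * n - C) = B * y + γ (n : ZMod p).val := by
    intro n hn y hy
    rw [ZMod.val_natCast] at hy ⊢
    have hmod := Nat.mod_add_div n p
    have := hγ (n % p) (Nat.mod_lt _ hp.out.pos) (n / p) (by rwa [hmod]) y hy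
    rwa [hmod] at this
  obtain ⟨a, d, had⟩ := hG.column_const_affine hp6 (by omega) hB _ A C (fun x => γ x.val) hc
  obtain ⟨A', hA'⟩ := ZMod.intCast_surjective (a / B)
  obtain ⟨C', hC'⟩ := ZMod.intCast_surjective (d / B)
  refine ⟨A + (p : ℤ) ^ (r + 1) * A', C + (p : ℤ) ^ (r + 1) * C', ?_⟩
  intro n hn m v hv e he he0
  rcases hv.lt_or_eq with hv | rfl
  · refine h.congr ?_ ?_ n hn m v (by omega) e he he0
    · simp [Int.ModEq]
    · simp [Int.ModEq]
  · have hval : B * ((e - A' * n - C' : ℤ) : ZMod p) + γ (n : ZMod p).val = B * e := by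
      rw [had]
      push_cast
      rw [hA', hC']
      field_simp
      ring
    have := hc n hn (e - A' * n - C') (by rw [hval]; exact mul_ne_zero hB he0)
    rw [hval] at this
    rw [← this]
    congr 1
    linear_combination he

theorem AdicStructure.exists_of_zero {p N : ℕ} [hp : Fact p.Prime] {G : ℕ → ℤ → ZMod p}
    (hG : IsAdicSolution p N G) (hp6 : 6 ≤ p) (hN : 2 * p + p * p ≤ N) {B : ZMod p} (hB : B ≠ 0)
    {A C : ℤ} (h : AdicStructure p N G B 0 A C) (r : ℕ) :
    ∃ A' C' : ℤ, AdicStructure p N G B r A' C' := by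
  induction r with
  | zero => exact ⟨A, C, h⟩
  | succ r ih =>
    obtain ⟨A', C', h'⟩ := ih
    exact h'.succ hG hp6 hN hB

/-! ### Approximate additive relations on a finite group -/

section Counting

variable {X Y K A : Type*} [Fintype X] [Fintype Y]

theorem card_filter_prod_right (P : X → Y → Prop) [∀ x y, Decidable (P x y)] :
    (Finset.univ.filter fun z : X × Y => P z.1 z.2).card =
      ∑ y, (Finset.univ.filter fun x => P x y).card := by
  simp only [Finset.card_filter]
  rw [Fintype.sum_prod_type_right]

theorem card_filter_prod_left (P : X → Y → Prop) [∀ x y, Decidable (P x y)] :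
    (Finset.univ.filter fun z : X × Y => P z.1 z.2).card =
      ∑ x, (Finset.univ.filter fun y => P x y).card := by
  simp only [Finset.card_filter]
  rw [Fintype.sum_prod_type]

theorem exists_card_mul_le_sum [Nonempty Y] (f : Y → ℕ) : ∃ y, f y * Fintype.card Y ≤ ∑ y, f y := by
  obtain ⟨y, -, hy⟩ := Finset.exists_min_image Finset.univ f Finset.univ_nonempty
  refine ⟨y, ?_⟩
  have := Finset.card_nsmul_le_sum Finset.univ f (f y) hy
  rwa [smul_eq_mul, Finset.card_univ, mul_comm] at this

/-- A point outside three sets which together are too small to cover. -/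
theorem exists_not_mem_three [DecidableEq X] (S T U : Finset X)
    (h : S.card + T.card + U.card < Fintype.card X) : ∃ x, x ∉ S ∧ x ∉ T ∧ x ∉ U := by
  have hcard : (S ∪ T ∪ U).card < (Finset.univ : Finset X).card := by
    rw [Finset.card_univ]
    have h1 := Finset.card_union_le (S ∪ T) U
    have h2 := Finset.card_union_le S T
    omega
  obtain ⟨x, -, hx⟩ := Finset.exists_mem_notMem_of_card_lt_card hcard
  exact ⟨x, by simpa [and_assoc] using hx⟩

variable [DecidableEq K]

/-- If `F x = H y` for more than two thirds of the pairs, then `F` and `H` are both nearly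
constant, with the same value. -/
theorem exists_const_of_collisions [Nonempty X] [Nonempty Y] (F : X → K) (H : Y → K) {b : ℕ}
    (hb : (Finset.univ.filter fun z : X × Y => F z.1 ≠ H z.2).card ≤ b)
    (hlt : 3 * b < Fintype.card X * Fintype.card Y) :
    ∃ c, (Finset.univ.filter fun x => F x ≠ c).card * Fintype.card Y ≤ b ∧
      (Finset.univ.filter fun y => H y ≠ c).card * Fintype.card X ≤ b := by
  classical
  obtain ⟨y₀, hy₀⟩ := exists_card_mul_le_sum fun y =>
    (Finset.univ.filter fun x => F x ≠ H y).card
  obtain ⟨x₀, hx₀⟩ := exists_card_mul_le_sum fun x =>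
    (Finset.univ.filter fun y => F x ≠ H y).card
  rw [← card_filter_prod_right fun x y => F x ≠ H y] at hy₀
  rw [← card_filter_prod_left fun x y => F x ≠ H y] at hx₀
  have h1 := hy₀.trans hb
  have h2 := hx₀.trans hb
  obtain ⟨⟨x, y⟩, e1, e2, e3⟩ := exists_not_mem_three (X := X × Y)
    ((Finset.univ.filter fun x => F x ≠ H y₀) ×ˢ Finset.univ)
    (Finset.univ ×ˢ (Finset.univ.filter fun y => F x₀ ≠ H y))
    (Finset.univ.filter fun z : X × Y => F z.1 ≠ H z.2) (by
      rw [Finset.card_product, Finset.card_product, Finset.card_univ, Finset.card_univ,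
        Fintype.card_prod]
      rw [mul_comm (Fintype.card X)]
      omega)
  simp only [Finset.mem_product, Finset.mem_filter, Finset.mem_univ, true_and, and_true,
    not_not] at e1 e2 e3
  refine ⟨H y₀, h1, ?_⟩
  have : F x₀ = H y₀ := by rw [e2, ← e3, e1]
  simpa [← this, eq_comm] using h2

variable [AddCommGroup A] [Fintype A] [AddCommGroup K]

/-- If `f (x + t) - f x` has, for each `t`, a value `c t` outside a set of `x` of density less
than one third, then `c` is a homomorphism. -/
theorem exists_hom_of_differences (f : A → K) (c : A → K) {b : ℕ}
    (hc : ∀ t, (Finset.univ.filter fun x => f (x + t) - f x ≠ c t).card * Fintype.card A ≤ 2 * b)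
    (hlt : 6 * b < Fintype.card A * Fintype.card A) : ∃ φ : A →+ K, ∀ t, φ t = c t := by
  classical
  refine ⟨AddMonoidHom.mk' c fun s t => ?_, fun t => rfl⟩
  have hshift : (Finset.univ.filter fun x => f (x + s + t) - f (x + s) ≠ c t).card =
      (Finset.univ.filter fun x => f (x + t) - f x ≠ c t).card := by
    refine Finset.card_bijective (fun x => x + s) (Equiv.addRight s).bijective ?_
    intro x
    simp
  obtain ⟨x, h1, h2, h3⟩ := exists_not_mem_three (Finset.univ.filter fun x => f (x + s) - f x ≠ c s)
    (Finset.univ.filter fun x => f (x + s + t) - f (x + s) ≠ c t)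
    (Finset.univ.filter fun x => f (x + (s + t)) - f x ≠ c (s + t)) (by
      rw [hshift]
      have h1 := hc s
      have h2 := hc t
      have h3 := hc (s + t)
      by_contra hcon
      push Not at hcon
      have := Nat.mul_le_mul_right (Fintype.card A) hcon
      rw [add_mul, add_mul] at this
      omega)
  simp only [Finset.mem_filter, Finset.mem_univ, true_and, not_not] at h1 h2 h3
  rw [← h1, ← h2, ← h3, add_assoc]
  abel

/-- If the differences of `f` are those of the homomorphism `φ`, apart from exceptions of density
less than one third, then `f` is `φ` plus a constant outside a set of density less than one
quarter: a set of density `u ≤ 1 / 3` of exceptions costs `2 u (1 - u)` of the pairs. -/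
theorem exists_const_of_differences (f : A → K) (φ : A →+ K) {b : ℕ}
    (hc : ∀ t, (Finset.univ.filter fun x => f (x + t) - f x ≠ φ t).card * Fintype.card A ≤ 2 * b)
    (hlt : 6 * b < Fintype.card A * Fintype.card A) :
    ∃ a, 4 * (Finset.univ.filter fun x => f x ≠ φ x + a).card ≤ Fintype.card A := by
  classical
  have hpairs : (Finset.univ.filter fun z : A × A => f z.1 - φ z.1 ≠ f z.2 - φ z.2).card ≤
      2 * b := by
    have hsum : (Finset.univ.filter fun z : A × A => f z.1 - φ z.1 ≠ f z.2 - φ z.2).card =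
        (Finset.univ.filter fun z : A × A => f (z.1 + z.2) - f z.1 ≠ φ z.2).card := by
      refine (Finset.card_bijective (fun z : A × A => (z.1, z.1 + z.2))
        ⟨?_, ?_⟩ ?_).symm
      · rintro ⟨x, y⟩ ⟨x', y'⟩ h
        simp only [Prod.mk.injEq] at h
        obtain ⟨rfl, h⟩ := h
        simpa using h
      · rintro ⟨x, y⟩
        exact ⟨(x, y - x), by simp⟩
      · rintro ⟨x, y⟩
        simp only [Finset.mem_filter, Finset.mem_univ, true_and, map_add, not_iff_not]
        constructor
        · intro h; rw [← h]; abel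
        · intro h
          have : f (x + y) = f x - φ x + (φ x + φ y) := by rw [h]; abel
          rw [this]; abel
    rw [hsum, card_filter_prod_right fun x t => f (x + t) - f x ≠ φ t]
    have h1 : ∑ t, (Finset.univ.filter fun x => f (x + t) - f x ≠ φ t).card * Fintype.card A ≤
        Fintype.card A * (2 * b) := by
      have := Finset.sum_le_card_nsmul Finset.univ
        (fun t => (Finset.univ.filter fun x => f (x + t) - f x ≠ φ t).card * Fintype.card A)
        (2 * b) fun t _ => hc t
      rwa [smul_eq_mul, Finset.card_univ] at this
    rw [← Finset.sum_mul, mul_comm] at h1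
    exact Nat.le_of_mul_le_mul_left h1 Fintype.card_pos
  obtain ⟨a, ha, -⟩ := exists_const_of_collisions (fun x => f x - φ x) (fun x => f x - φ x) hpairs
    (by omega)
  refine ⟨a, ?_⟩
  have hset : (Finset.univ.filter fun x => f x ≠ φ x + a) =
      Finset.univ.filter fun x => f x - φ x ≠ a := by
    ext x
    simp [sub_eq_iff_eq_add, add_comm]
  rw [hset]
  set S := Finset.univ.filter fun x => f x - φ x ≠ a with hS
  have hSc : S.card + Sᶜ.card = Fintype.card A := Finset.card_add_card_compl S
  have hsub : (S ×ˢ Sᶜ) ∪ (Sᶜ ×ˢ S) ⊆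
      Finset.univ.filter fun z : A × A => f z.1 - φ z.1 ≠ f z.2 - φ z.2 := by
    rintro ⟨x, y⟩ hz
    simp only [hS, Finset.mem_union, Finset.mem_product, Finset.mem_compl, Finset.mem_filter,
      Finset.mem_univ, true_and, not_not] at hz ⊢
    rcases hz with ⟨h1, h2⟩ | ⟨h1, h2⟩
    · rw [h2]; exact h1
    · rw [h1]; exact Ne.symm h2
  have hdisj : Disjoint (S ×ˢ Sᶜ) (Sᶜ ×ˢ S) := by
    rw [Finset.disjoint_product]
    exact Or.inl disjoint_compl_right
  have hle := (Finset.card_le_card hsub).trans hpairs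
  rw [Finset.card_union_of_disjoint hdisj, Finset.card_product, Finset.card_product] at hle
  set Q := Fintype.card A
  have h3 : 3 * S.card < Q := by
    by_contra hcon
    push Not at hcon
    have := Nat.mul_le_mul_right Q hcon
    nlinarith
  by_contra hcon
  push Not at hcon
  nlinarith

/-- If `f x + g z = h (x + z)` holds for more than five sixths of the pairs, then `f`, `g` and `h`
nearly coincide with translates of one homomorphism, and the three translations are compatible. -/
theorem exists_hom_of_approx_additive (f g h : A → K) {b : ℕ}
    (hb : (Finset.univ.filter fun z : A × A => f z.1 + g z.2 ≠ h (z.1 + z.2)).card ≤ b)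
    (hlt : 6 * b < Fintype.card A * Fintype.card A) :
    ∃ (φ : A →+ K) (u v : K),
      4 * (Finset.univ.filter fun x => f x ≠ φ x + u).card ≤ Fintype.card A ∧
      4 * (Finset.univ.filter fun x => g x ≠ φ x + v).card ≤ Fintype.card A ∧
      3 * (Finset.univ.filter fun x => h x ≠ φ x + (u + v)).card ≤ Fintype.card A := by
  classical
  set S := Finset.univ.filter fun z : A × A => f z.1 + g z.2 ≠ h (z.1 + z.2) with hS
  have hdiff : ∀ t, ∃ c,
      (Finset.univ.filter fun x => f (x + t) - f x ≠ c).card * Fintype.card A ≤ 2 * b ∧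
      (Finset.univ.filter fun x => g (x + t) - g x ≠ c).card * Fintype.card A ≤ 2 * b := by
    intro t
    refine exists_const_of_collisions (fun x => f (x + t) - f x) (fun x => g (x + t) - g x)
      ?_ (by omega)
    have hsub : (Finset.univ.filter fun z : A × A =>
        f (z.1 + t) - f z.1 ≠ g (z.2 + t) - g z.2) ⊆
        S.image (fun z => (z.1 - t, z.2)) ∪ S.image (fun z => (z.1, z.2 - t)) := by
      rintro ⟨x, z⟩ hz
      simp only [hS, Finset.mem_union, Finset.mem_image, Finset.mem_filter, Finset.mem_univ,
        true_and, Prod.mk.injEq, Prod.exists] at hz ⊢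
      by_contra hcon
      push Not at hcon
      have h1 : f (x + t) + g z = h (x + t + z) := by
        by_contra h0; exact hcon.1 (x + t) z h0 (by abel) rfl
      have h2 : f x + g (z + t) = h (x + (z + t)) := by
        by_contra h0; exact hcon.2 x (z + t) h0 rfl (by abel)
      apply hz
      rw [sub_eq_sub_iff_add_eq_add, h1, add_comm (g (z + t)), h2]
      congr 1; abel
    have h1 := Finset.card_le_card hsub
    have h2 := Finset.card_union_le (S.image fun z => (z.1 - t, z.2))
      (S.image fun z => (z.1, z.2 - t))
    have h3 : (S.image fun z => (z.1 - t, z.2)).card ≤ S.card := Finset.card_image_le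
    have h4 : (S.image fun z => (z.1, z.2 - t)).card ≤ S.card := Finset.card_image_le
    omega
  choose c hcf hcg using hdiff
  obtain ⟨φ, hφ⟩ := exists_hom_of_differences f c hcf hlt
  simp only [← hφ] at hcf hcg
  obtain ⟨u, hu⟩ := exists_const_of_differences f φ hcf hlt
  obtain ⟨v, hv⟩ := exists_const_of_differences g φ hcg hlt
  refine ⟨φ, u, v, hu, hv, ?_⟩
  set U := Finset.univ.filter fun x => f x ≠ φ x + u with hU
  set V := Finset.univ.filter fun x => g x ≠ φ x + v with hV
  set W := Finset.univ.filter fun x => h x ≠ φ x + (u + v) with hW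
  -- Each exceptional value of `h` spoils at least half of the pairs over it.
  have hfib : ∀ w ∈ W, Fintype.card A ≤
      2 * (Finset.univ.filter fun x => f x + g (w - x) ≠ h w).card := by
    intro w hw
    have hV' : (Finset.univ.filter fun x => w - x ∈ V).card = V.card := by
      refine Finset.card_bijective (fun x => w - x) (Equiv.subLeft w).bijective ?_
      intro x; simp
    by_contra hcon
    push Not at hcon
    obtain ⟨x, h1, h2, h3⟩ := exists_not_mem_three U (Finset.univ.filter fun x => w - x ∈ V)
      (Finset.univ.filter fun x => f x + g (w - x) ≠ h w) (by omega)
    simp only [hU, hV, hW, Finset.mem_filter, Finset.mem_univ, true_and, not_not] at h1 h2 h3 hw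
    apply hw
    rw [← h3, h1, h2, map_sub]
    abel
  have hsum : ∑ w, (Finset.univ.filter fun x => f x + g (w - x) ≠ h w).card = S.card := by
    rw [← card_filter_prod_right fun x w => f x + g (w - x) ≠ h w]
    refine Finset.card_bijective (fun z : A × A => (z.1, z.2 - z.1)) ⟨?_, ?_⟩ ?_
    · rintro ⟨x, y⟩ ⟨x', y'⟩ h
      simp only [Prod.mk.injEq] at h
      obtain ⟨rfl, h⟩ := h
      simpa using h
    · rintro ⟨x, y⟩
      exact ⟨(x, y + x), by simp⟩
    · rintro ⟨x, y⟩
      simp [hS]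
  have h1 : W.card * Fintype.card A ≤ 2 * S.card := by
    rw [← hsum, Finset.mul_sum]
    refine le_trans ?_ (Finset.sum_le_sum_of_subset (Finset.subset_univ W))
    rw [← smul_eq_mul]
    exact Finset.card_nsmul_le_sum _ _ _ hfib
  by_contra hcon
  push Not at hcon
  have := Nat.mul_le_mul_right (Fintype.card A) hcon.le
  nlinarith

end Counting

/-! ### The structure of a solution modulo `p` -/

/-- A column of digits `g : ℤ → ZMod p` is given by a function `f` on `ZMod q`, outside a set `E` of
at most `s` residue classes, and `f` takes no value more than `t` times. -/
structure IsGoodColumn (p q : ℕ) (g : ℤ → ZMod p) (f : ZMod q → ZMod p) (E : Finset (ZMod q))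
    (s t : ℕ) : Prop where
  eq_of_notMem : ∀ m : ℤ, (m : ZMod q) ∉ E → g m = f m
  card_le : E.card ≤ s
  fiber : ∀ c (S : Finset (ZMod q)), (∀ x ∈ S, f x = c) → S.card ≤ t

theorem card_natCast_fiber_le {p p' q : ℕ} (hq : q = p * p') [NeZero q] (c : ZMod p)
    (S : Finset (ZMod q)) (hS : ∀ y ∈ S, ((y.val : ℕ) : ZMod p) = c) :
    S.card ≤ p' := by
  rw [← Finset.card_range p']
  refine Finset.card_le_card_of_injOn (fun y => y.val / p) ?_ ?_
  · intro y _
    simp only [Finset.coe_range, Set.mem_Iio]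
    apply Nat.div_lt_of_lt_mul
    rw [← hq]
    exact ZMod.val_lt y
  · intro x hx y hy hxy
    have h1 := (ZMod.natCast_eq_natCast_iff' _ _ _).1 ((hS x hx).trans (hS y hy).symm)
    apply ZMod.val_injective q
    rw [← Nat.mod_add_div x.val p, ← Nat.mod_add_div y.val p, h1]
    congr 2

/-- A column of digits that obeys the initial condition is good: the exceptional residue classes are
those which the permutation makes divisible by `p` or `p'`. -/
theorem exists_isGoodColumn {p p' q : ℕ} (hp : p.Prime) (hp' : p'.Prime) (hq : q = p * p')
    [NeZero q] (g : ℤ → ZMod p) (σ : Equiv.Perm (ZMod q))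
    (h : ∀ m : ℤ, ¬ Nat.Coprime (σ m).val q ∨ g m = ((σ m).val : ZMod p)) :
    ∃ f E, IsGoodColumn p q g f E (p + p') p' := by
  classical
  refine ⟨fun x => ((σ x).val : ZMod p),
    (Finset.univ.filter fun x => (((σ x).val : ℕ) : ZMod p) = 0) ∪
      (Finset.univ.filter fun x => (((σ x).val : ℕ) : ZMod p') = 0), ?_, ?_, ?_⟩
  · intro m hm
    refine (h m).resolve_left (not_not.2 ?_)
    simp only [Finset.mem_union, Finset.mem_filter, Finset.mem_univ, true_and, not_or,
      ZMod.natCast_eq_zero_iff] at hm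
    have hcop := Nat.Coprime.mul_right ((hp.coprime_iff_not_dvd.2 hm.1).symm)
      ((hp'.coprime_iff_not_dvd.2 hm.2).symm)
    rwa [← hq] at hcop
  · refine (Finset.card_union_le _ _).trans ?_
    rw [add_comm p]
    refine add_le_add ?_ ?_
    · rw [← Finset.card_map σ.toEmbedding]
      refine card_natCast_fiber_le hq 0 _ ?_
      intro y hy
      obtain ⟨x, hx, rfl⟩ := Finset.mem_map.1 hy
      simpa using hx
    · rw [← Finset.card_map σ.toEmbedding]
      refine card_natCast_fiber_le (hq.trans (mul_comm _ _)) 0 _ ?_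
      intro y hy
      obtain ⟨x, hx, rfl⟩ := Finset.mem_map.1 hy
      simpa using hx
  · intro c S hS
    rw [← Finset.card_map σ.toEmbedding]
    refine card_natCast_fiber_le hq c _ ?_
    intro y hy
    obtain ⟨x, hx, rfl⟩ := Finset.mem_map.1 hy
    exact hS x hx

/-- For some three consecutive columns, few lines have an affine form with a zero in one of
them. -/
theorem exists_few_zeros {p : ℕ} [hp : Fact p.Prime] {X : Type*} [Fintype X] (a b : X → ZMod p)
    (hab : ∀ x, ¬ (a x = 0 ∧ b x = 0)) : ∃ n < p,
    (∑ k ∈ Finset.range 3, (Finset.univ.filter fun x => a x * ((n + k : ℕ) : ZMod p) + b x = 0).card)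
      * p ≤ 3 * Fintype.card X := by
  classical
  have : Nonempty (Fin p) := ⟨⟨0, hp.out.pos⟩⟩
  obtain ⟨n, hn⟩ := exists_card_mul_le_sum (Y := Fin p) fun n => ∑ k ∈ Finset.range 3,
    (Finset.univ.filter fun x => a x * (((n : ℕ) + k : ℕ) : ZMod p) + b x = 0).card
  refine ⟨n, n.2, ?_⟩
  rw [Fintype.card_fin] at hn
  refine hn.trans ?_
  rw [Finset.sum_comm]
  have hk : ∀ k ∈ Finset.range 3, ∑ n : Fin p,
      (Finset.univ.filter fun x => a x * (((n : ℕ) + k : ℕ) : ZMod p) + b x = 0).card ≤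
        Fintype.card X := by
    intro k _
    rw [← card_filter_prod_right fun x (n : Fin p) => a x * (((n : ℕ) + k : ℕ) : ZMod p) + b x = 0,
      card_filter_prod_left fun x (n : Fin p) => a x * (((n : ℕ) + k : ℕ) : ZMod p) + b x = 0]
    refine (Finset.sum_le_card_nsmul _ _ 1 fun x _ => ?_).trans (by simp)
    rw [Finset.card_le_one]
    intro n hn m hm
    simp only [Finset.mem_filter, Finset.mem_univ, true_and] at hn hm
    have ha : a x ≠ 0 := fun ha => hab x ⟨ha, by simpa [ha] using hn⟩
    have h1 := mul_left_cancel₀ ha (add_right_cancel (hn.trans hm.symm))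
    push_cast at h1
    have h2 := (ZMod.natCast_eq_natCast_iff' _ _ _).1 (add_right_cancel h1)
    rw [Nat.mod_eq_of_lt n.2, Nat.mod_eq_of_lt m.2] at h2
    exact Fin.ext h2
  refine (Finset.sum_le_card_nsmul _ _ _ hk).trans ?_
  simp

theorem card_filter_affine_mem {A : Type*} [CommRing A] [Fintype A] [DecidableEq A] (c : A)
    (E : Finset A) : (Finset.univ.filter fun z : A × A => z.1 * c + z.2 ∈ E).card =
      E.card * Fintype.card A := by
  rw [card_filter_prod_left fun j i => j * c + i ∈ E, mul_comm]
  rw [Finset.sum_const_nat (m := E.card), Finset.card_univ]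
  intro j _
  refine Finset.card_bijective (fun i => j * c + i) (Equiv.addLeft (j * c)).bijective ?_
  intro i; simp

/-- Three consecutive columns, on which most lines do not have a zero, are nearly translates of one
homomorphism on `ZMod q`, with constants in arithmetic progression. -/
theorem exists_three_columns {p p' q N : ℕ} [hp : Fact p.Prime] [NeZero q] (hq : q = p * p')
    (hq2 : IsUnit (2 : ZMod q)) (h53 : 53 ≤ p) (h53' : 53 ≤ p') (h59 : 59 ≤ p ∨ 59 ≤ p')
    (hN : p + 2 ≤ N) {G : ℕ → ℤ → ZMod p} (hG : IsAdicSolution p N G)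
    (f : ℕ → ZMod q → ZMod p) (E : ℕ → Finset (ZMod q))
    (hcol : ∀ n < N, IsGoodColumn p q (G n) (f n) (E n) (p + p') p') :
    ∃ n₀ < p, ∃ (φ : ZMod q →+ ZMod p) (u v : ZMod p) (U : ℕ → Finset (ZMod q)),
      4 * (U 0).card ≤ q ∧ 3 * (U 1).card ≤ q ∧ 4 * (U 2).card ≤ q ∧
      ∀ k < 3, ∀ x ∉ U k, f (n₀ + k) x = φ x + (u + k * v) := by
  classical
  choose a b hab using hG.line
  obtain ⟨n, hn, hsum⟩ := exists_few_zeros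
    (fun z : ZMod q × ZMod q => (a z.1.val z.2.val : ZMod p))
    (fun z : ZMod q × ZMod q => (b z.1.val z.2.val : ZMod p)) (fun z => (hab _ _).nondeg)
  set Z : ℕ → Finset (ZMod q × ZMod q) := fun k => Finset.univ.filter fun z =>
    (a z.1.val z.2.val : ZMod p) * ((n + k : ℕ) : ZMod p) + (b z.1.val z.2.val : ZMod p) = 0
    with hZ
  set V : ℕ → Finset (ZMod q × ZMod q) := fun k => Finset.univ.filter fun z =>
    z.1 * ((n + k : ℕ) : ZMod q) + z.2 ∈ E (n + k) with hV
  have hVc : ∀ k < 3, (V k).card ≤ (p + p') * q := by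
    intro k hk
    rw [hV]
    dsimp only
    rw [card_filter_affine_mem, ZMod.card]
    exact Nat.mul_le_mul_right _ (hcol (n + k) (by omega)).card_le
  have hp2 : (2 : ZMod p) ≠ 0 := by
    have : ((2 : ℕ) : ZMod p) ≠ 0 := by
      rw [Ne, ZMod.natCast_eq_zero_iff]
      intro h
      have := Nat.le_of_dvd two_pos h
      omega
    simpa using this
  -- The columns on both sides determine the middle one at the midpoint, hence the inverse of `2`.
  obtain ⟨d, hd⟩ := hq2.exists_right_inv
  have hgood : ∀ (z : ZMod q × ZMod q), ∀ k < 3, z ∉ Z k → z ∉ V k →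
      f (n + k) (z.1 * ((n + k : ℕ) : ZMod q) + z.2) =
        (a z.1.val z.2.val : ZMod p) * ((n + k : ℕ) : ZMod p) + (b z.1.val z.2.val : ZMod p) := by
    intro z k hk h1 h2
    simp only [hZ, hV, Finset.mem_filter, Finset.mem_univ, true_and] at h1 h2
    have hcast : (((z.1.val : ℤ) * ((n + k : ℕ) : ℤ) + (z.2.val : ℤ) : ℤ) : ZMod q) =
        z.1 * ((n + k : ℕ) : ZMod q) + z.2 := by
      push_cast; simp
    rw [← (hab z.1.val z.2.val).unit (n + k) (by omega) h1, ← hcast]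
    refine ((hcol (n + k) (by omega)).eq_of_notMem _ ?_).symm
    rwa [hcast]
  set T := Z 0 ∪ Z 1 ∪ Z 2 ∪ (V 0 ∪ V 1 ∪ V 2) with hT
  have hTc : T.card ≤ (Z 0).card + (Z 1).card + (Z 2).card + 3 * ((p + p') * q) := by
    have h1 := hVc 0 (by norm_num)
    have h2 := hVc 1 (by norm_num)
    have h3 := hVc 2 (by norm_num)
    have e1 := Finset.card_union_le (Z 0 ∪ Z 1 ∪ Z 2) (V 0 ∪ V 1 ∪ V 2)
    rw [← hT] at e1
    have e2 := Finset.card_union_le (Z 0 ∪ Z 1) (Z 2)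
    have e3 := Finset.card_union_le (Z 0) (Z 1)
    have e4 := Finset.card_union_le (V 0 ∪ V 1) (V 2)
    have e5 := Finset.card_union_le (V 0) (V 1)
    omega
  have hbad : (Finset.univ.filter fun z : ZMod q × ZMod q =>
      f n z.1 + f (n + 2) z.2 ≠ 2 * f (n + 1) (d * (z.1 + z.2))).card ≤ T.card := by
    refine le_trans (Finset.card_le_card ?_) (Finset.card_image_le (s := T)
      (f := fun z => (z.1 * (n : ZMod q) + z.2, z.1 * ((n + 2 : ℕ) : ZMod q) + z.2)))
    rintro ⟨x, z⟩ hxz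
    simp only [Finset.mem_filter, Finset.mem_univ, true_and] at hxz
    rw [Finset.mem_image]
    refine ⟨(d * (z - x), x - d * (z - x) * n), ?_, ?_⟩
    · by_contra hcon
      simp only [hT, Finset.mem_union, not_or] at hcon
      obtain ⟨⟨⟨z0, z1⟩, z2⟩, ⟨v0, v1⟩, v2⟩ := hcon
      have g0 := hgood _ 0 (by norm_num) z0 v0
      have g1 := hgood _ 1 (by norm_num) z1 v1
      have g2 := hgood _ 2 (by norm_num) z2 v2
      rw [show d * (z - x) * ((n + 0 : ℕ) : ZMod q) + (x - d * (z - x) * n) = x by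
        push_cast; ring] at g0
      rw [show d * (z - x) * ((n + 1 : ℕ) : ZMod q) + (x - d * (z - x) * n) = d * (x + z) by
        push_cast; linear_combination -x * hd] at g1
      rw [show d * (z - x) * ((n + 2 : ℕ) : ZMod q) + (x - d * (z - x) * n) = z by
        push_cast; linear_combination (z - x) * hd] at g2
      apply hxz
      rw [add_zero] at g0
      rw [g0, g1, g2]
      push_cast
      ring
    · refine Prod.ext ?_ ?_
      · simp
      · push_cast
        linear_combination (z - x) * hd
  have hlt : 6 * ((Z 0).card + (Z 1).card + (Z 2).card + 3 * ((p + p') * q)) < q * q := by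
    have hsum' : ((Z 0).card + (Z 1).card + (Z 2).card) * p ≤ 3 * (q * q) := by
      rw [Finset.sum_range_succ, Finset.sum_range_succ, Finset.sum_range_one, Fintype.card_prod,
        ZMod.card] at hsum
      exact hsum
    have hp0 : 0 < p := by omega
    have hq0 : 0 < q := Nat.pos_of_ne_zero (NeZero.ne q)
    -- The total density of exceptions, `3 / p + 3 (p + p') / q`, has to be less than `1 / 6`. This
    -- holds for the primes `53` and `59`, with little to spare.
    have key : 18 * q + 18 * ((p + p') * p) < q * p := by
      rw [hq]
      have : 18 * p' + 18 * (p + p') < p * p' := by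
        obtain ⟨x, rfl⟩ := Nat.exists_eq_add_of_le h53
        obtain ⟨y, rfl⟩ := Nat.exists_eq_add_of_le h53'
        rcases h59 with h | h <;> nlinarith [Nat.zero_le (x * y)]
      nlinarith
    refine Nat.lt_of_mul_lt_mul_right (a := p) ?_
    calc 6 * ((Z 0).card + (Z 1).card + (Z 2).card + 3 * ((p + p') * q)) * p
        = 6 * (((Z 0).card + (Z 1).card + (Z 2).card) * p) + q * (18 * ((p + p') * p)) := by ring
      _ ≤ 6 * (3 * (q * q)) + q * (18 * ((p + p') * p)) := by gcongr
      _ = q * (18 * q + 18 * ((p + p') * p)) := by ring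
      _ < q * (q * p) := Nat.mul_lt_mul_of_pos_left key hq0
      _ = q * q * p := by ring
  obtain ⟨φ, u, v, hu, hv, hw⟩ := exists_hom_of_approx_additive (f n) (f (n + 2))
    (fun w => 2 * f (n + 1) (d * w)) (hbad.trans hTc) (by rwa [ZMod.card])
  rw [ZMod.card] at hu hv hw
  refine ⟨n, hn, φ, u, (v - u) / 2, fun k => if k = 0 then
    (Finset.univ.filter fun x => f n x ≠ φ x + u) else if k = 1 then
    (Finset.univ.filter fun x => f (n + 1) x ≠ φ x + (u + v) / 2) else
    (Finset.univ.filter fun x => f (n + 2) x ≠ φ x + v), by simpa using hu, ?_, by simpa using hv,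
    ?_⟩
  · refine le_trans ?_ hw
    simp only [one_ne_zero, if_true, if_false]
    refine Nat.mul_le_mul_left _ (Finset.card_le_card_of_injOn (fun x => 2 * x) ?_ ?_)
    · intro x hx
      simp only [Finset.coe_filter, Finset.mem_univ, true_and, Set.mem_ofPred_eq] at hx ⊢
      intro h0
      apply hx
      rw [show d * (2 * x) = x by linear_combination x * hd, two_mul x, map_add] at h0
      field_simp
      linear_combination h0
    · intro x _ y _ hxy
      exact hq2.mul_left_cancel hxy
  · intro k hk x hx
    interval_cases k
    · simpa using hx
    · simp only [one_ne_zero, if_true, if_false, Finset.mem_filter, Finset.mem_univ, true_and,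
        not_not] at hx
      rw [hx]
      push_cast
      field_simp
      ring
    · simp only [if_false, OfNat.ofNat_ne_zero, OfNat.ofNat_ne_one, Finset.mem_filter,
        Finset.mem_univ, true_and, not_not] at hx
      rw [hx]
      push_cast
      field_simp
      ring

/-- If three consecutive columns are nearly affine, then so is, up to zeros only, every column whose
distances to them are invertible modulo `q`: some line through a given point meets the three columns
at typical points, and the affine form of this line vanishes in at most one of them. -/
theorem IsAdicSolution.eq_affine_of_three_columns {p q N : ℕ} [hp : Fact p.Prime] [NeZero q]
    (hp3 : 3 ≤ p) {G : ℕ → ℤ → ZMod p} (hG : IsAdicSolution p N G) {n₀ : ℕ} (hn₀ : n₀ + 2 < N)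
    (W : ℕ → Finset (ZMod q)) (hW : (W 0).card + (W 1).card + (W 2).card < q) {B a c : ZMod p}
    (h : ∀ k < 3, ∀ m : ℤ, (m : ZMod q) ∉ W k →
      G (n₀ + k) m = B * m + a * ((n₀ + k : ℕ) : ZMod p) + c)
    {n : ℕ} (hn : n < N) (hunit : ∀ k < 3, IsUnit (((n₀ + k : ℕ) : ZMod q) - n)) (m : ℤ)
    (hne : B * m + a * n + c ≠ 0) : G n m = B * m + a * n + c := by
  classical
  have hcard : ∀ k < 3, (Finset.univ.filter fun j : ZMod q =>
      (m : ZMod q) + j * (((n₀ + k : ℕ) : ZMod q) - n) ∈ W k).card = (W k).card := by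
    intro k hk
    refine Finset.card_bijective (fun j : ZMod q => (m : ZMod q) + j * (((n₀ + k : ℕ) : ZMod q) - n))
      ?_ ?_
    · refine Finite.injective_iff_bijective.1 ?_
      intro x y hxy
      exact (hunit k hk).mul_right_cancel (add_left_cancel hxy)
    · intro j; simp
  obtain ⟨j, h0, h1, h2⟩ := exists_not_mem_three
    (Finset.univ.filter fun j : ZMod q => (m : ZMod q) + j * (((n₀ + 0 : ℕ) : ZMod q) - n) ∈ W 0)
    (Finset.univ.filter fun j : ZMod q => (m : ZMod q) + j * (((n₀ + 1 : ℕ) : ZMod q) - n) ∈ W 1)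
    (Finset.univ.filter fun j : ZMod q => (m : ZMod q) + j * (((n₀ + 2 : ℕ) : ZMod q) - n) ∈ W 2)
    (by rw [hcard 0 (by norm_num), hcard 1 (by norm_num), hcard 2 (by norm_num), ZMod.card]
        exact hW)
  simp only [Finset.mem_filter, Finset.mem_univ, true_and] at h0 h1 h2
  have hj : ∀ k < 3, (m : ZMod q) + j * (((n₀ + k : ℕ) : ZMod q) - n) ∉ W k := by
    intro k hk
    interval_cases k <;> assumption
  obtain ⟨α, β, hab⟩ := hG.line j.val (m - j.val * n)
  have heq := affine_eq_of_three _ (card_image_natCast_Ico (s := n₀) hp3).ge hab.nondeg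
    (c := B * (j.val : ℕ) + a) (d := B * (m - (j.val : ℕ) * n) + c) (by
      intro x hx hx0
      obtain ⟨n', hn', rfl⟩ := Finset.mem_image.1 hx
      rw [Finset.mem_Ico] at hn'
      obtain ⟨k, rfl⟩ := Nat.exists_eq_add_of_le hn'.1
      rw [← hab.unit (n₀ + k) (by omega) hx0, h k (by omega)]
      · push_cast; ring
      · have := hj k (by omega)
        have hcast : (((j.val : ℤ) * ((n₀ + k : ℕ) : ℤ) + (m - j.val * n) : ℤ) : ZMod q) =
            m + j * (((n₀ + k : ℕ) : ZMod q) - n) := by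
          push_cast
          rw [ZMod.natCast_zmod_val]
          ring
        rwa [hcast])
  have hval : (α : ZMod p) * n + β = B * m + a * n + c := by
    rw [← heq.1, ← heq.2]; ring
  have := hab.unit n hn (by rwa [hval])
  rw [hval] at this
  rw [← this]
  congr 1; ring

/-- A solution of the `p`-adic Sudoku with good columns is, modulo `p`, an affine function outside
the zeros of this function, and this function is not constant along the columns. -/
theorem IsAdicSolution.exists_adicStructure_zero {p p' q N : ℕ} [hp : Fact p.Prime]
    (hp' : p'.Prime) [NeZero q] (hq : q = p * p')
    (h53 : 53 ≤ p) (h53' : 53 ≤ p') (h59 : 59 ≤ p ∨ 59 ≤ p')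
    (hN : p + 7 ≤ N) {G : ℕ → ℤ → ZMod p} (hG : IsAdicSolution p N G)
    (f : ℕ → ZMod q → ZMod p) (E : ℕ → Finset (ZMod q))
    (hcol : ∀ n < N, IsGoodColumn p q (G n) (f n) (E n) (p + p') p') :
    ∃ (B : ZMod p) (A C : ℤ), B ≠ 0 ∧ AdicStructure p N G B 0 A C := by
  classical
  have hunit : ∀ d : ℕ, 0 < d → d < 53 → IsUnit (d : ZMod q) := by
    intro d hd0 hd
    rw [ZMod.isUnit_iff_coprime, hq]
    exact Nat.Coprime.mul_right (Nat.coprime_of_lt_prime hd0.ne' (by omega) hp.out).symm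
      (Nat.coprime_of_lt_prime hd0.ne' (by omega) hp').symm
  have hq0 : 53 * p' ≤ q := by rw [hq]; exact Nat.mul_le_mul_right _ h53
  have hq1 : 53 * p ≤ q := by rw [hq, mul_comm p]; exact Nat.mul_le_mul_right _ h53'
  obtain ⟨n₀, hn₀, φ, u, v, U, hU0, hU1, hU2, hφ⟩ := exists_three_columns hq
    (by simpa using hunit 2 (by norm_num) (by norm_num)) h53 h53' h59 (by omega) hG f E hcol
  set B := φ 1 with hB
  have hφB : ∀ m : ℤ, φ (m : ZMod q) = B * m := by
    intro m
    rw [← zsmul_one, map_zsmul, zsmul_eq_mul, mul_comm]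
  -- A homomorphism that vanishes would make the first column take one value too often.
  have hB0 : B ≠ 0 := by
    intro hB0
    have hzero : ∀ x : ZMod q, φ x = 0 := by
      intro x
      obtain ⟨m, rfl⟩ := ZMod.intCast_surjective x
      rw [hφB, hB0, zero_mul]
    have h1 := (hcol n₀ (by omega)).fiber u (U 0)ᶜ (by
      intro x hx
      have := hφ 0 (by norm_num) x (Finset.mem_compl.1 hx)
      simpa [hzero] using this)
    rw [Finset.card_compl, ZMod.card] at h1
    omega
  set W : ℕ → Finset (ZMod q) := fun k => U k ∪ E (n₀ + k) with hW
  have hWc : ∀ k < 3, (W k).card ≤ (U k).card + (p + p') := by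
    intro k hk
    exact (Finset.card_union_le _ _).trans
      (Nat.add_le_add_left (hcol (n₀ + k) (by omega)).card_le _)
  have hWsum : (W 0).card + (W 1).card + (W 2).card < q := by
    have h0 := hWc 0 (by norm_num)
    have h1 := hWc 1 (by norm_num)
    have h2 := hWc 2 (by norm_num)
    omega
  have hthree : ∀ k < 3, ∀ m : ℤ, (m : ZMod q) ∉ W k →
      G (n₀ + k) m = B * m + v * ((n₀ + k : ℕ) : ZMod p) + (u - v * n₀) := by
    intro k hk m hm
    rw [hW, Finset.mem_union, not_or] at hm
    rw [(hcol (n₀ + k) (by omega)).eq_of_notMem m hm.2, hφ k hk _ hm.1, hφB]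
    push_cast; ring
  -- The next four columns have distances at most `6`, hence prime to `q`, to the first three.
  have hfour : ∀ n, n₀ + 3 ≤ n → n < n₀ + 3 + 4 → ∀ m : ℤ, B * m + v * n + (u - v * n₀) ≠ 0 →
      G n m = B * m + v * n + (u - v * n₀) := by
    intro n hn1 hn2 m hne
    refine hG.eq_affine_of_three_columns (by omega) (by omega) W hWsum hthree (by omega) ?_ m hne
    intro k hk
    have := (hunit (n - (n₀ + k)) (by omega) (by omega)).neg
    rwa [Nat.cast_sub (by omega), neg_sub] at this
  -- The horizontal lines carry this over to all columns.
  have hall : ∀ n < N, ∀ m : ℤ, B * m + v * n + (u - v * n₀) ≠ 0 →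
      G n m = B * m + v * n + (u - v * n₀) := by
    intro n hn m hne
    obtain ⟨a, b, hab⟩ := hG.line 0 m
    have heq := hab.eq_of_agree (n₀ + 3) (by omega) (by omega) (c := v)
      (d := B * m + (u - v * n₀)) ?_ ?_
    · have hval : (a : ZMod p) * n + b = B * m + v * n + (u - v * n₀) := by
        rw [heq.1, heq.2]; ring
      have := hab.unit n hn (by rwa [hval])
      rw [hval] at this
      simpa using this
    · rintro ⟨h1, h2⟩
      apply hne
      linear_combination h2 + n * h1
    · intro n' h1 h2 h3
      have h4 : v * n' + (B * m + (u - v * n₀)) = B * m + v * n' + (u - v * n₀) := by ring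
      rw [h4] at h3 ⊢
      simpa using hfour n' h1 h2 m h3
  obtain ⟨A, hA⟩ := ZMod.intCast_surjective (v / B)
  obtain ⟨C, hC⟩ := ZMod.intCast_surjective ((u - v * (n₀ : ZMod p)) / B)
  refine ⟨B, A, C, hB0, ?_⟩
  intro n hn m w hw e he he0
  obtain rfl : w = 0 := by omega
  rw [pow_zero, one_mul] at he
  have hval : B * m + v * n + (u - v * n₀) = B * e := by
    rw [← he]
    push_cast
    rw [hA, hC]
    field_simp
  rw [hall n hn m (by rw [hval]; exact mul_ne_zero hB0 he0), hval]

/-! ### Reading off the domino function -/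

/-- Along a line on which the digits are a non-zero constant, the affine form is constant. -/
theorem AgreesWithLine.of_const {p N : ℕ} [hp : Fact p.Prime] {g : ℕ → ZMod p} {a b : ℤ}
    (h : AgreesWithLine p N g a b) (hp4 : 4 ≤ p) (hN : 4 ≤ N) {c : ZMod p} (hc : c ≠ 0)
    (hg : ∀ n < N, g n = c) : (p : ℤ) ∣ a ∧ ¬ (p : ℤ) ∣ b := by
  have := h.eq_of_agree 0 (by omega) hp4 (c := 0) (d := c) (fun h0 => hc h0.2)
    (fun n _ hn _ => by rw [zero_mul, zero_add]; exact hg n (by omega))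
  exact ⟨(ZMod.intCast_zmod_eq_zero_iff_dvd _ _).1 this.1,
    intCast_ne_zero_iff.1 (by rw [this.2]; exact hc)⟩

/-- Along a line on which the digits are those of `s n`, to second order, the affine form `a n + b`
has the same valuations as `n`, to second order. -/
theorem AgreesWithLine.of_linear {p N : ℕ} [hp : Fact p.Prime] {g : ℕ → ZMod p} {a b : ℤ}
    (h : AgreesWithLine p N g a b) (hp4 : 4 ≤ p) (hN : 2 * p < N) {s : ZMod p} (hs : s ≠ 0)
    (hg : ∀ n < N, (n : ZMod p) ≠ 0 → g n = s * n)
    (hg' : ∀ k, p * k < N → (k : ZMod p) ≠ 0 → g (p * k) = s * k) :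
    ¬ (p : ℤ) ∣ a ∧ (p : ℤ) * p ∣ b := by
  have hab := h.eq_of_agree 0 (by omega) hp4 (c := s) (d := 0) (fun h0 => hs h0.1) (by
    intro n _ hn h0
    rw [add_zero] at h0 ⊢
    exact hg n (by omega) (right_ne_zero_of_mul h0))
  have ha : (a : ZMod p) ≠ 0 := by rw [hab.1]; exact hs
  refine ⟨intCast_ne_zero_iff.1 ha, ?_⟩
  obtain ⟨b', rfl⟩ := (ZMod.intCast_zmod_eq_zero_iff_dvd _ _).1 hab.2
  refine mul_dvd_mul_left _ ?_
  by_contra hb'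
  rw [← intCast_ne_zero_iff] at hb'
  have hval : ∀ k : ℕ, ((a * k + b' : ℤ) : ZMod p) = s * k + b' := by
    intro k; push_cast; rw [hab.1]
  -- If `p ^ 2 ∤ b`, then the second-order digits leave only this possibility.
  have hz : ∀ k : ℕ, p * k < N → (k : ZMod p) ≠ 0 → s * k + b' = 0 := by
    intro k hk hk0
    by_contra h0
    have h1 := h.prime ha (p * k) hk (a * k + b') (by push_cast; ring) (by rwa [hval])
    rw [hval, hg' k hk hk0] at h1
    exact hb' (by linear_combination -h1)
  have h2 : ((2 : ℕ) : ZMod p) ≠ 0 := by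
    rw [Ne, ZMod.natCast_eq_zero_iff]
    intro h2
    have := Nat.le_of_dvd two_pos h2
    omega
  have e1 := hz 1 (by omega) (by simp)
  have e2 := hz 2 (by omega) h2
  push_cast at e1 e2
  exact hs (by linear_combination e2 - e1)

/-- The columns of a function on the board, indexed by all natural numbers `n`: only those with
`n < N` are of interest, and the others are repetitions of these. -/
def boardColumn {N : ℕ} [NeZero N] {D : Type*} (F : Fin N × ℤ → D) (n : ℕ) (m : ℤ) : D :=
  F (Fin.ofNat N n, m)

theorem exists_line_form {p₁ p₂ : ℕ} [Fact p₁.Prime] [Fact p₂.Prime] [NeZero (p₁ ^ 2 * p₂ ^ 2)]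
    {W : Type*} {R : DominoSet W} {F : Fin (p₁ ^ 2 * p₂ ^ 2) × ℤ → DecoratedDigit p₁ p₂ W}
    (hF : IsSudokuSolution (decoratedRule p₁ p₂ R) F) (j i : ℤ) :
    ∃ a b : ℤ,
      AgreesWithLine p₁ (p₁ ^ 2 * p₂ ^ 2)
        (fun n => ((boardColumn F n (j * n + i)).1 : ZMod p₁)) a b ∧
      AgreesWithLine p₂ (p₁ ^ 2 * p₂ ^ 2)
        (fun n => ((boardColumn F n (j * n + i)).2.1 : ZMod p₂)) a b ∧
      ∃ T : tRect p₁ p₂ a → W, R.IsDominoFunction (tRect p₁ p₂ a) T ∧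
        ∀ n < p₁ ^ 2 * p₂ ^ 2, ∀ v₁ v₂ : ℕ,
          nu p₁ (a * (n : ℤ) + b) = v₁ → nu p₂ (a * (n : ℤ) + b) = v₂ →
          ∀ h : ((v₁ : ℤ), (v₂ : ℤ)) ∈ tRect p₁ p₂ a,
            (boardColumn F n (j * n + i)).2.2 = T ⟨((v₁ : ℤ), (v₂ : ℤ)), h⟩ := by
  obtain ⟨a, b, hab₁, hab₂, T, hT, h⟩ := hF j i
  have hboard : ∀ n (hn : n < p₁ ^ 2 * p₂ ^ 2), ∀ m, boardColumn F n m = F (⟨n, hn⟩, m) := by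
    intro n hn m
    simp [boardColumn, Fin.ofNat, Nat.mod_eq_of_lt hn]
  refine ⟨a, b, agreesWithLine_of_lastDigit hab₁ ?_, agreesWithLine_of_lastDigit hab₂ ?_, T, hT, ?_⟩
  · intro n hn h0
    rw [hboard n hn, (h ⟨n, hn⟩).1 h0]
  · intro n hn h0
    rw [hboard n hn, (h ⟨n, hn⟩).2.1 h0]
  · intro n hn v₁ v₂ h1 h2 h3
    rw [hboard n hn]
    exact (h ⟨n, hn⟩).2.2 v₁ v₂ h1 h2 h3

theorem Int.exists_modEq_modEq {P Q : ℤ} (h : IsCoprime P Q) (x y : ℤ) :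
    ∃ z, z ≡ x [ZMOD P] ∧ z ≡ y [ZMOD Q] := by
  obtain ⟨u, v, huv⟩ := h
  refine ⟨x * (v * Q) + y * (u * P), ?_, ?_⟩
  · exact (Int.modEq_of_dvd ⟨(x - y) * u, by linear_combination (-x) * huv⟩)
  · exact (Int.modEq_of_dvd ⟨(y - x) * v, by linear_combination (-y) * huv⟩)

/-- A solution of the decorated Sudoku whose digits have adic structure, for one affine function
and both primes, up to order `K` yields domino relations on the square of size `K`: the pip at `r`
is the common decoration of the line on which the affine function equals `p₁ ^ r₁ * p₂ ^ r₂`, and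
neighbouring such lines are linked by the line on which it equals `p₁ ^ r₁ * p₂ ^ r₂ * n`. -/
theorem exists_domino_square {p₁ p₂ : ℕ} [hp₁ : Fact p₁.Prime] [hp₂ : Fact p₂.Prime]
    (hne : p₁ ≠ p₂) (h₁ : 4 ≤ p₁) (h₂ : 4 ≤ p₂) [NeZero (p₁ ^ 2 * p₂ ^ 2)] {W : Type*}
    {R : DominoSet W} {F : Fin (p₁ ^ 2 * p₂ ^ 2) × ℤ → DecoratedDigit p₁ p₂ W}
    (hF : IsSudokuSolution (decoratedRule p₁ p₂ R) F) {B₁ : ZMod p₁} {B₂ : ZMod p₂}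
    (hB₁ : B₁ ≠ 0) (hB₂ : B₂ ≠ 0) {K : ℕ} {A C : ℤ}
    (hS₁ : AdicStructure p₁ (p₁ ^ 2 * p₂ ^ 2) (fun n m => ((boardColumn F n m).1 : ZMod p₁)) B₁ K A C)
    (hS₂ : AdicStructure p₂ (p₁ ^ 2 * p₂ ^ 2) (fun n m => ((boardColumn F n m).2.1 : ZMod p₂))
      B₂ K A C) :
    ∃ T : ℕ → ℕ → W, ∀ r₁ < K, ∀ r₂ < K,
      (T r₁ r₂, T (r₁ + 1) r₂) ∈ R.R₁ ∧ (T r₁ r₂, T r₁ (r₂ + 1)) ∈ R.R₂ := by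
  have hN₁ : 2 * p₁ < p₁ ^ 2 * p₂ ^ 2 := by nlinarith [Nat.mul_le_mul h₁ h₂]
  have hN₂ : 2 * p₂ < p₁ ^ 2 * p₂ ^ 2 := by nlinarith [Nat.mul_le_mul h₁ h₂]
  have h12 : ¬ (p₁ : ℤ) ∣ p₂ := by
    rw [Int.natCast_dvd_natCast, Nat.prime_dvd_prime_iff_eq hp₁.out hp₂.out]
    exact hne
  have h21 : ¬ (p₂ : ℤ) ∣ p₁ := by
    rw [Int.natCast_dvd_natCast, Nat.prime_dvd_prime_iff_eq hp₂.out hp₁.out]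
    exact hne.symm
  have hp21 : ∀ r : ℕ, (p₂ : ZMod p₁) ^ r ≠ 0 := fun r => pow_ne_zero _ (by
    have := intCast_ne_zero_iff.2 h12
    simpa using this)
  have hp12 : ∀ r : ℕ, (p₁ : ZMod p₂) ^ r ≠ 0 := fun r => pow_ne_zero _ (by
    have := intCast_ne_zero_iff.2 h21
    simpa using this)
  -- The decoration is constant on the lines of constant affine function.
  have hconst : ∀ r₁ ≤ K, ∀ r₂ ≤ K, ∀ n < p₁ ^ 2 * p₂ ^ 2,
      (boardColumn F n ((p₁ : ℤ) ^ r₁ * (p₂ : ℤ) ^ r₂ - A * n - C)).2.2 =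
        (boardColumn F 0 ((p₁ : ℤ) ^ r₁ * (p₂ : ℤ) ^ r₂ - C)).2.2 := by
    intro r₁ hr₁ r₂ hr₂
    obtain ⟨a, b, hab₁, hab₂, T, -, hT⟩ :=
      exists_line_form hF (-A) ((p₁ : ℤ) ^ r₁ * (p₂ : ℤ) ^ r₂ - C)
    obtain ⟨ha₁, hb₁⟩ := hab₁.of_const h₁ (by omega) (c := B₁ * (p₂ : ZMod p₁) ^ r₂)
      (mul_ne_zero hB₁ (hp21 r₂)) (by
        intro n hn
        have := hS₁ n hn (-A * n + ((p₁ : ℤ) ^ r₁ * (p₂ : ℤ) ^ r₂ - C)) r₁ hr₁ ((p₂ : ℤ) ^ r₂)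
          (by ring) (by push_cast; exact hp21 r₂)
        refine this.trans ?_
        push_cast; rfl)
    obtain ⟨ha₂, hb₂⟩ := hab₂.of_const h₂ (by omega) (c := B₂ * (p₁ : ZMod p₂) ^ r₁)
      (mul_ne_zero hB₂ (hp12 r₁)) (by
        intro n hn
        have := hS₂ n hn (-A * n + ((p₁ : ℤ) ^ r₁ * (p₂ : ℤ) ^ r₂ - C)) r₂ hr₂ ((p₁ : ℤ) ^ r₁)
          (by ring) (by push_cast; exact hp12 r₁)
        refine this.trans ?_
        push_cast; rfl)
    have hmem : (((0 : ℕ) : ℤ), ((0 : ℕ) : ℤ)) ∈ tRect p₁ p₂ a := by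
      rw [tRect, tIndex_of_dvd ha₁, tIndex_of_dvd ha₂]
      simp
    have hall : ∀ n < p₁ ^ 2 * p₂ ^ 2,
        (boardColumn F n (-A * n + ((p₁ : ℤ) ^ r₁ * (p₂ : ℤ) ^ r₂ - C))).2.2 = T ⟨_, hmem⟩ :=
      fun n hn => hT n hn 0 0
        (nu_eq_zero fun h => hb₁ ((Int.dvd_add_right (ha₁.mul_right _)).1 h))
        (nu_eq_zero fun h => hb₂ ((Int.dvd_add_right (ha₂.mul_right _)).1 h)) hmem
    intro n hn
    have e1 := hall n hn
    have e2 := hall 0 (by omega)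
    rw [← e2] at e1
    rw [show (p₁ : ℤ) ^ r₁ * (p₂ : ℤ) ^ r₂ - A * n - C =
      -A * n + ((p₁ : ℤ) ^ r₁ * (p₂ : ℤ) ^ r₂ - C) by ring, e1]
    simp
  refine ⟨fun r₁ r₂ => (boardColumn F 0 ((p₁ : ℤ) ^ r₁ * (p₂ : ℤ) ^ r₂ - C)).2.2, ?_⟩
  intro r₁ hr₁ r₂ hr₂
  obtain ⟨a, b, hab₁, hab₂, T, ⟨hT₁, hT₂⟩, hT⟩ :=
    exists_line_form hF ((p₁ : ℤ) ^ r₁ * (p₂ : ℤ) ^ r₂ - A) (-C)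
  obtain ⟨ha₁, hb₁⟩ := hab₁.of_linear h₁ hN₁ (s := B₁ * (p₂ : ZMod p₁) ^ r₂)
    (mul_ne_zero hB₁ (hp21 r₂)) (by
      intro n hn hn0
      have := hS₁ n hn (((p₁ : ℤ) ^ r₁ * (p₂ : ℤ) ^ r₂ - A) * n + -C) r₁ hr₁.le
        ((p₂ : ℤ) ^ r₂ * n) (by ring) (by push_cast; exact mul_ne_zero (hp21 r₂) hn0)
      refine this.trans ?_
      push_cast; ring) (by
      intro k hk hk0
      have := hS₁ (p₁ * k) hk (((p₁ : ℤ) ^ r₁ * (p₂ : ℤ) ^ r₂ - A) * ((p₁ * k : ℕ) : ℤ) + -C)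
        (r₁ + 1) hr₁ ((p₂ : ℤ) ^ r₂ * k) (by push_cast; ring)
        (by push_cast; exact mul_ne_zero (hp21 r₂) hk0)
      refine this.trans ?_
      push_cast; ring)
  obtain ⟨ha₂, hb₂⟩ := hab₂.of_linear h₂ hN₂ (s := B₂ * (p₁ : ZMod p₂) ^ r₁)
    (mul_ne_zero hB₂ (hp12 r₁)) (by
      intro n hn hn0
      have := hS₂ n hn (((p₁ : ℤ) ^ r₁ * (p₂ : ℤ) ^ r₂ - A) * n + -C) r₂ hr₂.le
        ((p₁ : ℤ) ^ r₁ * n) (by ring) (by push_cast; exact mul_ne_zero (hp12 r₁) hn0)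
      refine this.trans ?_
      push_cast; ring) (by
      intro k hk hk0
      have := hS₂ (p₂ * k) hk (((p₁ : ℤ) ^ r₁ * (p₂ : ℤ) ^ r₂ - A) * ((p₂ * k : ℕ) : ℤ) + -C)
        (r₂ + 1) hr₂ ((p₁ : ℤ) ^ r₁ * k) (by push_cast; ring)
        (by push_cast; exact mul_ne_zero (hp12 r₁) hk0)
      refine this.trans ?_
      push_cast; ring)
  have hrect : tRect p₁ p₂ a = Set.Icc (0, 0) (1, 1) := by
    rw [tRect, tIndex_of_not_dvd ha₁, tIndex_of_not_dvd ha₂]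
    simp
  have m00 : (((0 : ℕ) : ℤ), ((0 : ℕ) : ℤ)) ∈ tRect p₁ p₂ a := by rw [hrect]; simp
  have m10 : (((1 : ℕ) : ℤ), ((0 : ℕ) : ℤ)) ∈ tRect p₁ p₂ a := by rw [hrect]; simp
  have m01 : (((0 : ℕ) : ℤ), ((1 : ℕ) : ℤ)) ∈ tRect p₁ p₂ a := by rw [hrect]; simp
  have hunit : ∀ {p : ℕ} (_ : p.Prime) (_ : ¬ (p : ℤ) ∣ a) (_ : (p : ℤ) * p ∣ b) (n : ℕ)
      (_ : ¬ (p : ℤ) ∣ n), nu p (a * n + b) = (0 : ℕ) := by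
    intro p hp ha hb n hn
    have hb' : (p : ℤ) ∣ b := (dvd_mul_right _ _).trans hb
    refine nu_eq_zero fun h => ?_
    rcases (Nat.prime_iff_prime_int.1 hp).dvd_or_dvd ((Int.dvd_add_left hb').1 h) with h | h
    · exact ha h
    · exact hn h
  have hprime : ∀ {p : ℕ} (_ : p.Prime) (_ : ¬ (p : ℤ) ∣ a) (_ : (p : ℤ) * p ∣ b),
      nu p (a * p + b) = (1 : ℕ) := by
    intro p hp ha hb
    obtain ⟨c, rfl⟩ := hb
    have := nu_pow_mul hp 1 (e := a + p * c)
      (fun h => ha ((Int.dvd_add_left (dvd_mul_right _ _)).1 h))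
    rwa [show (p : ℤ) ^ 1 * (a + p * c) = a * p + p * p * c by ring] at this
  have hone : ∀ {p : ℕ} (_ : p.Prime), ¬ (p : ℤ) ∣ ((1 : ℕ) : ℤ) := by
    intro p hp h
    rw [Int.natCast_dvd_natCast] at h
    exact hp.one_lt.ne' (Nat.dvd_one.1 h)
  have w00 := hT 1 (by omega) 0 0 (hunit hp₁.out ha₁ hb₁ 1 (hone hp₁.out))
    (hunit hp₂.out ha₂ hb₂ 1 (hone hp₂.out)) m00
  have w10 := hT p₁ (by omega) 1 0 (hprime hp₁.out ha₁ hb₁) (hunit hp₂.out ha₂ hb₂ p₁ h21) m10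
  have w01 := hT p₂ (by omega) 0 1 (hunit hp₁.out ha₁ hb₁ p₂ h12) (hprime hp₂.out ha₂ hb₂) m01
  have c00 := hconst r₁ hr₁.le r₂ hr₂.le 1 (by omega)
  have c10 := hconst (r₁ + 1) hr₁ r₂ hr₂.le p₁ (by omega)
  have c01 := hconst r₁ hr₁.le (r₂ + 1) hr₂ p₂ (by omega)
  rw [show (p₁ : ℤ) ^ r₁ * (p₂ : ℤ) ^ r₂ - A * ((1 : ℕ) : ℤ) - C =
    ((p₁ : ℤ) ^ r₁ * (p₂ : ℤ) ^ r₂ - A) * ((1 : ℕ) : ℤ) + -C by push_cast; ring, w00] at c00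
  rw [show (p₁ : ℤ) ^ (r₁ + 1) * (p₂ : ℤ) ^ r₂ - A * p₁ - C =
    ((p₁ : ℤ) ^ r₁ * (p₂ : ℤ) ^ r₂ - A) * p₁ + -C by ring, w10] at c10
  rw [show (p₁ : ℤ) ^ r₁ * (p₂ : ℤ) ^ (r₂ + 1) - A * p₂ - C =
    ((p₁ : ℤ) ^ r₁ * (p₂ : ℤ) ^ r₂ - A) * p₂ + -C by ring, w01] at c01
  dsimp only
  rw [← c00, ← c10, ← c01]
  exact ⟨hT₁ (((0 : ℕ) : ℤ), ((0 : ℕ) : ℤ)) m00 m10, hT₂ (((0 : ℕ) : ℤ), ((0 : ℕ) : ℤ)) m00 m01⟩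

/-- Domino functions on arbitrarily large squares, for a finite set of pips, yield one on the
quadrant, as a limit along an ultrafilter. -/
theorem solvableOn_quadrant_of_squares {W : Type*} [Finite W] {R : DominoSet W}
    (h : ∀ K : ℕ, ∃ T : ℕ → ℕ → W, ∀ r₁ < K, ∀ r₂ < K,
      (T r₁ r₂, T (r₁ + 1) r₂) ∈ R.R₁ ∧ (T r₁ r₂, T r₁ (r₂ + 1)) ∈ R.R₂) :
    R.SolvableOn quadrant := by
  choose T hT using h
  have hlim : ∀ r₁ r₂, ∃ w, ∀ᶠ K in (Filter.hyperfilter ℕ : Filter ℕ), T K r₁ r₂ = w := by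
    intro r₁ r₂
    exact Ultrafilter.eventually_exists_iff.1 (Filter.Eventually.of_forall fun K => ⟨_, rfl⟩)
  choose L hL using hlim
  have hlarge : ∀ r, ∀ᶠ K in (Filter.hyperfilter ℕ : Filter ℕ), r < K := fun r =>
    Filter.Eventually.filter_mono Nat.hyperfilter_le_atTop (Filter.eventually_gt_atTop r)
  have hR : ∀ r₁ r₂, (L r₁ r₂, L (r₁ + 1) r₂) ∈ R.R₁ ∧ (L r₁ r₂, L r₁ (r₂ + 1)) ∈ R.R₂ := by
    intro r₁ r₂
    obtain ⟨K, e0, e1, e2, e3, e4⟩ := ((hL r₁ r₂).and ((hL (r₁ + 1) r₂).and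
      ((hL r₁ (r₂ + 1)).and ((hlarge r₁).and (hlarge r₂))))).exists
    rw [← e0, ← e1, ← e2]
    exact hT K r₁ e3 r₂ e4
  refine ⟨fun s => L s.1.1.toNat s.1.2.toNat, ?_, ?_⟩
  · rintro ⟨x, y⟩ ⟨hx, hy⟩ h'
    dsimp only at hx hy
    have := (hR x.toNat y.toNat).1
    simpa [Int.toNat_add hx] using this
  · rintro ⟨x, y⟩ ⟨hx, hy⟩ h'
    dsimp only at hx hy
    have := (hR x.toNat y.toNat).2
    simpa [Int.toNat_add hy] using this

theorem Nat.Prime.eq_53_or_59_le {p : ℕ} (hp : p.Prime) (h : 48 < p) : p = 53 ∨ 59 ≤ p := by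
  by_contra! hcon
  obtain ⟨h1, h2⟩ := hcon
  interval_cases p <;> first | exact h1 rfl | exact absurd hp (by norm_num)

theorem solvableOn_quadrant_of_sudokuSolvable {p₁ p₂ : ℕ} [hp₁ : Fact p₁.Prime]
    [hp₂ : Fact p₂.Prime] (hne : p₁ ≠ p₂) (h₁ : 48 < p₁) (h₂ : 48 < p₂) {W : Type*} [Finite W]
    {R : DominoSet W} (h : SudokuSolvable (decoratedRule p₁ p₂ R) (decoratedInitial p₁ p₂ W)) :
    R.SolvableOn quadrant := by
  obtain ⟨F, hF, hI⟩ := h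
  have h53 : 53 ≤ p₁ := by rcases hp₁.out.eq_53_or_59_le h₁ with h | h <;> omega
  have h53' : 53 ≤ p₂ := by rcases hp₂.out.eq_53_or_59_le h₂ with h | h <;> omega
  have h59 : 59 ≤ p₁ ∨ 59 ≤ p₂ := by
    rcases hp₁.out.eq_53_or_59_le h₁ with h | h <;>
      rcases hp₂.out.eq_53_or_59_le h₂ with h' | h' <;> omega
  have : NeZero (p₁ * p₂) := ⟨mul_ne_zero hp₁.out.ne_zero hp₂.out.ne_zero⟩
  have hN0 : p₁ ^ 2 * p₂ ^ 2 ≠ 0 :=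
    mul_ne_zero (pow_ne_zero _ hp₁.out.ne_zero) (pow_ne_zero _ hp₂.out.ne_zero)
  have : NeZero (p₁ ^ 2 * p₂ ^ 2) := ⟨hN0⟩
  have hN₁ : 2 * p₁ + p₁ * p₁ ≤ p₁ ^ 2 * p₂ ^ 2 := by
    have : 2 ≤ p₂ ^ 2 := by nlinarith
    calc 2 * p₁ + p₁ * p₁ ≤ p₁ ^ 2 * 2 := by nlinarith
      _ ≤ _ := Nat.mul_le_mul_left _ this
  have hN₂ : 2 * p₂ + p₂ * p₂ ≤ p₁ ^ 2 * p₂ ^ 2 := by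
    have : 2 ≤ p₁ ^ 2 := by nlinarith
    calc 2 * p₂ + p₂ * p₂ ≤ 2 * p₂ ^ 2 := by nlinarith
      _ ≤ _ := Nat.mul_le_mul_right _ this
  have hG₁ : IsAdicSolution p₁ (p₁ ^ 2 * p₂ ^ 2) fun n m => ((boardColumn F n m).1 : ZMod p₁) :=
    ⟨fun _ _ _ => Units.ne_zero _, fun j i => by
      obtain ⟨a, b, hab, -⟩ := exists_line_form hF j i
      exact ⟨a, b, hab⟩⟩
  have hG₂ : IsAdicSolution p₂ (p₁ ^ 2 * p₂ ^ 2) fun n m => ((boardColumn F n m).2.1 : ZMod p₂) :=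
    ⟨fun _ _ _ => Units.ne_zero _, fun j i => by
      obtain ⟨a, b, -, hab, -⟩ := exists_line_form hF j i
      exact ⟨a, b, hab⟩⟩
  choose σ hσ using hI
  -- The columns are good without a bound on `n`, as `boardColumn` repeats genuine columns.
  choose f₁ E₁ hc₁ using fun n : ℕ => exists_isGoodColumn hp₁.out hp₂.out rfl
    (fun m => ((boardColumn F n m).1 : ZMod p₁)) (σ (Fin.ofNat _ n))
    (fun m => (hσ (Fin.ofNat _ n) m).imp_right And.left)
  choose f₂ E₂ hc₂ using fun n : ℕ => exists_isGoodColumn hp₂.out hp₁.out (mul_comm _ _)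
    (fun m => ((boardColumn F n m).2.1 : ZMod p₂)) (σ (Fin.ofNat _ n))
    (fun m => (hσ (Fin.ofNat _ n) m).imp_right And.right)
  obtain ⟨B₁, A₁, C₁, hB₁, hS₁⟩ := hG₁.exists_adicStructure_zero hp₂.out rfl h53 h53' h59
    (by nlinarith) f₁ E₁ fun n _ => hc₁ n
  obtain ⟨B₂, A₂, C₂, hB₂, hS₂⟩ := hG₂.exists_adicStructure_zero hp₁.out (mul_comm _ _) h53' h53
    h59.symm (by nlinarith) f₂ E₂ fun n _ => hc₂ n
  refine solvableOn_quadrant_of_squares fun K => ?_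
  obtain ⟨A₁', C₁', hK₁⟩ := hS₁.exists_of_zero hG₁ (by omega) hN₁ hB₁ K
  obtain ⟨A₂', C₂', hK₂⟩ := hS₂.exists_of_zero hG₂ (by omega) hN₂ hB₂ K
  have hcop : IsCoprime ((p₁ : ℤ) ^ (K + 1)) ((p₂ : ℤ) ^ (K + 1)) :=
    (Nat.isCoprime_iff_coprime.2 ((Nat.coprime_primes hp₁.out hp₂.out).2 hne)).pow
  obtain ⟨A, hA₁, hA₂⟩ := Int.exists_modEq_modEq hcop A₁' A₂'
  obtain ⟨C, hC₁, hC₂⟩ := Int.exists_modEq_modEq hcop C₁' C₂'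
  exact exists_domino_square hne (by omega) (by omega) hF hB₁ hB₂ (hK₁.congr hA₁ hC₁)
    (hK₂.congr hA₂ hC₂)

/-! ### From a domino function to a Sudoku solution -/

/-- Multiplication by `p₁ ^ r₁ * p₂ ^ r₂` can be replaced, as regards the last non-zero digits, by
multiplication by an integer prime to `p₁` and `p₂`. -/
theorem exists_unit_multiplier {p₁ p₂ : ℕ} [hp₁ : Fact p₁.Prime] [hp₂ : Fact p₂.Prime]
    (hne : p₁ ≠ p₂) (r₁ r₂ : ℕ) : ∃ c : ℤ, ¬ (p₁ : ℤ) ∣ c ∧ ¬ (p₂ : ℤ) ∣ c ∧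
      ∀ x : ℤ, x ≠ 0 →
        nu p₁ (c * x) = nu p₁ x ∧ nu p₂ (c * x) = nu p₂ x ∧
        lastDigit p₁ ((p₁ : ℤ) ^ r₁ * (p₂ : ℤ) ^ r₂ * x) = lastDigit p₁ (c * x) ∧
        lastDigit p₂ ((p₁ : ℤ) ^ r₁ * (p₂ : ℤ) ^ r₂ * x) = lastDigit p₂ (c * x) := by
  have hP₁ := Nat.prime_iff_prime_int.1 hp₁.out
  have hP₂ := Nat.prime_iff_prime_int.1 hp₂.out
  have h12 : ¬ (p₁ : ℤ) ∣ (p₂ : ℤ) ^ r₂ := by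
    intro h
    have := hP₁.dvd_of_dvd_pow h
    rw [Int.natCast_dvd_natCast, Nat.prime_dvd_prime_iff_eq hp₁.out hp₂.out] at this
    exact hne this
  have h21 : ¬ (p₂ : ℤ) ∣ (p₁ : ℤ) ^ r₁ := by
    intro h
    have := hP₂.dvd_of_dvd_pow h
    rw [Int.natCast_dvd_natCast, Nat.prime_dvd_prime_iff_eq hp₂.out hp₁.out] at this
    exact hne this.symm
  obtain ⟨c, hc₁, hc₂⟩ := Int.exists_modEq_modEq
    (Nat.isCoprime_iff_coprime.2 ((Nat.coprime_primes hp₁.out hp₂.out).2 hne))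
    ((p₂ : ℤ) ^ r₂) ((p₁ : ℤ) ^ r₁)
  have hcp₁ : ¬ (p₁ : ℤ) ∣ c := fun h => h12 (hc₁.dvd_iff.1 h)
  have hcp₂ : ¬ (p₂ : ℤ) ∣ c := fun h => h21 (hc₂.dvd_iff.1 h)
  refine ⟨c, hcp₁, hcp₂, fun x hx => ?_⟩
  have key : ∀ {p : ℕ} [hp : Fact p.Prime] (_ : ¬ (p : ℤ) ∣ c) (r : ℕ) (d : ℤ)
      (_ : ¬ (p : ℤ) ∣ d) (_ : c ≡ d [ZMOD p]),
      nu p (c * x) = nu p x ∧ lastDigit p ((p : ℤ) ^ r * d * x) = lastDigit p (c * x) := by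
    intro p hp hcp r d hd hcd
    have hP := Nat.prime_iff_prime_int.1 hp.out
    obtain ⟨v, e, rfl, he⟩ := Int.exists_eq_pow_mul_of_prime hp.out hx
    have hce : ¬ (p : ℤ) ∣ c * e := fun h => (hP.dvd_or_dvd h).elim hcp he
    have hde : ¬ (p : ℤ) ∣ d * e := fun h => (hP.dvd_or_dvd h).elim hd he
    rw [show c * ((p : ℤ) ^ v * e) = (p : ℤ) ^ v * (c * e) by ring,
      show (p : ℤ) ^ r * d * ((p : ℤ) ^ v * e) = (p : ℤ) ^ (r + v) * (d * e) by ring,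
      nu_pow_mul hp.out _ hce, nu_pow_mul hp.out _ he]
    refine ⟨rfl, Units.ext ?_⟩
    rw [lastDigit_pow_mul p _ hde, lastDigit_pow_mul p _ hce]
    push_cast
    rw [(ZMod.intCast_eq_intCast_iff _ _ _).2 hcd]
  obtain ⟨n1, l1⟩ := key hcp₁ r₁ _ h12 hc₁
  obtain ⟨n2, l2⟩ := key hcp₂ r₂ _ h21 hc₂
  refine ⟨n1, n2, l1, ?_⟩
  rw [← l2, mul_comm ((p₁ : ℤ) ^ r₁)]

/-- A non-zero integer affine form is `p ^ r` times one that is non-degenerate modulo `p`. -/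
theorem exists_eq_pow_mul_nonDegenerate {p : ℕ} (hp : p.Prime) {j i : ℤ} (h : ¬ (j = 0 ∧ i = 0)) :
    ∃ (r : ℕ) (a b : ℤ), j = (p : ℤ) ^ r * a ∧ i = (p : ℤ) ^ r * b ∧
      ¬ ((p : ℤ) ∣ a ∧ (p : ℤ) ∣ b) := by
  have hg : (Int.gcd j i : ℤ) ≠ 0 := by
    rw [Ne, Int.natCast_eq_zero, Int.gcd_eq_zero_iff]
    exact h
  obtain ⟨r, e, he, hpe⟩ := Int.exists_eq_pow_mul_of_prime hp hg
  obtain ⟨a, ha⟩ : (p : ℤ) ^ r ∣ j := (Dvd.intro _ he.symm).trans (Int.gcd_dvd_left ..)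
  obtain ⟨b, hb⟩ : (p : ℤ) ^ r ∣ i := (Dvd.intro _ he.symm).trans (Int.gcd_dvd_right ..)
  refine ⟨r, a, b, ha, hb, fun hab => hpe ?_⟩
  have h1 : (p : ℤ) ^ r * p ∣ (Int.gcd j i : ℤ) := by
    refine Int.dvd_coe_gcd ?_ ?_
    · rw [ha]; exact mul_dvd_mul_left _ hab.1
    · rw [hb]; exact mul_dvd_mul_left _ hab.2
  rw [he] at h1
  exact Int.dvd_of_mul_dvd_mul_left (pow_ne_zero _ (by exact_mod_cast hp.ne_zero)) h1

theorem nonDegenerate_iff {p : ℕ} {a b : ℤ} :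
    NonDegenerate p a b ↔ ¬ ((p : ℤ) ∣ a ∧ (p : ℤ) ∣ b) := by
  unfold NonDegenerate
  rw [ZMod.intCast_zmod_eq_zero_iff_dvd, ZMod.intCast_zmod_eq_zero_iff_dvd]

theorem ne_zero_of_nu_le {p : ℕ} {x : ℤ} {t : ℕ} (h : nu p x ≤ t) : x ≠ 0 := by
  rintro rfl
  rw [nu_zero, top_le_iff] at h
  exact ENat.natCast_ne_top _ h

theorem nu_pow_mul_pow_mul {p p' : ℕ} (hp : p.Prime) (hp' : p'.Prime) (hne : p ≠ p') (r r' : ℕ)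
    {x : ℤ} {v : ℕ} (h : nu p x = v) : nu p ((p : ℤ) ^ r * (p' : ℤ) ^ r' * x) = (r + v : ℕ) := by
  have hP := Nat.prime_iff_prime_int.1 hp
  obtain ⟨e, rfl, he⟩ := nu_eq_coe h
  have hpe : ¬ (p : ℤ) ∣ (p' : ℤ) ^ r' * e := by
    intro h
    rcases hP.dvd_or_dvd h with h | h
    · have := hP.dvd_of_dvd_pow h
      rw [Int.natCast_dvd_natCast, Nat.prime_dvd_prime_iff_eq hp hp'] at this
      exact hne this
    · exact he h
  rw [show (p : ℤ) ^ r * (p' : ℤ) ^ r' * ((p : ℤ) ^ v * e) =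
    (p : ℤ) ^ (r + v) * ((p' : ℤ) ^ r' * e) by ring, nu_pow_mul hp _ hpe]

/-- The solution of the decorated Sudoku given by a function `V` on the quadrant: all columns are
equal, and consist of the last non-zero digits of `m`, with the value of `V` at the valuations of
`m` as decoration. -/
noncomputable def adicBoard (p₁ p₂ : ℕ) [Fact p₁.Prime] [Fact p₂.Prime] {W : Type*} (V : ℕ → ℕ → W)
    (N : ℕ) (x : Fin N × ℤ) : DecoratedDigit p₁ p₂ W :=
  (lastDigit p₁ x.2, lastDigit p₂ x.2, V (nu p₁ x.2).toNat (nu p₂ x.2).toNat)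

theorem isSudokuSolution_adicBoard {p₁ p₂ : ℕ} [hp₁ : Fact p₁.Prime] [hp₂ : Fact p₂.Prime]
    (hne : p₁ ≠ p₂) {W : Type*} {R : DominoSet W} {V : ℕ → ℕ → W}
    (hV₁ : ∀ r₁ r₂, (V r₁ r₂, V (r₁ + 1) r₂) ∈ R.R₁)
    (hV₂ : ∀ r₁ r₂, (V r₁ r₂, V r₁ (r₂ + 1)) ∈ R.R₂) :
    IsSudokuSolution (decoratedRule p₁ p₂ R) (adicBoard p₁ p₂ V (p₁ ^ 2 * p₂ ^ 2)) := by
  intro j i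
  have hP₁ := Nat.prime_iff_prime_int.1 hp₁.out
  have hP₂ := Nat.prime_iff_prime_int.1 hp₂.out
  by_cases h0 : j = 0 ∧ i = 0
    -- On the line of zeros, the digits are those of the constant form `1`, since `f_p(0) = 1`.
  · obtain ⟨rfl, rfl⟩ := h0
    have hone : ∀ {p : ℕ} [hp : Fact p.Prime], lastDigit p (0 : ℤ) = lastDigit p 1 := by
      intro p hp
      refine Units.ext ?_
      rw [lastDigit_of_not_dvd p (Nat.prime_iff_prime_int.1 hp.out).not_dvd_one]
      simp [lastDigit]
    have hrect : tRect p₁ p₂ 0 = {(0, 0)} := by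
      rw [tRect, tIndex_of_dvd (dvd_zero _), tIndex_of_dvd (dvd_zero _)]
      exact Set.Icc_self _
    refine ⟨0, 1, nonDegenerate_iff.2 fun h => hP₁.not_dvd_one h.2,
      nonDegenerate_iff.2 fun h => hP₂.not_dvd_one h.2, fun _ => V 0 0, ⟨?_, ?_⟩, ?_⟩
    · intro s h h'
      rw [hrect, Set.mem_singleton_iff] at h h'
      rw [h] at h'
      simp at h'
    · intro s h h'
      rw [hrect, Set.mem_singleton_iff] at h h'
      rw [h] at h'
      simp at h'
    · intro n
      simp [adicBoard, hone, nu_zero]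
  obtain ⟨r₁, j', i', hj, hi, hnd₁⟩ := exists_eq_pow_mul_nonDegenerate hp₁.out h0
  have h0' : ¬ (j' = 0 ∧ i' = 0) := fun h => hnd₁ ⟨h.1 ▸ dvd_zero _, h.2 ▸ dvd_zero _⟩
  obtain ⟨r₂, a, b, ha, hb, hnd₂⟩ := exists_eq_pow_mul_nonDegenerate hp₂.out h0'
  obtain ⟨c, hc₁, hc₂, hc⟩ := exists_unit_multiplier hne r₁ r₂
  have hrect : ∀ s ∈ tRect p₁ p₂ (c * a), 0 ≤ s.1 ∧ 0 ≤ s.2 := fun s hs => ⟨hs.1.1, hs.1.2⟩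
  refine ⟨c * a, c * b, nonDegenerate_iff.2 ?_, nonDegenerate_iff.2 ?_,
    fun s => V (r₁ + s.1.1.toNat) (r₂ + s.1.2.toNat), ⟨?_, ?_⟩, ?_⟩
  · rintro ⟨h1, h2⟩
    have h1 := (hP₁.dvd_or_dvd h1).resolve_left hc₁
    have h2 := (hP₁.dvd_or_dvd h2).resolve_left hc₁
    exact hnd₁ ⟨ha ▸ h1.mul_left _, hb ▸ h2.mul_left _⟩
  · rintro ⟨h1, h2⟩
    exact hnd₂ ⟨(hP₂.dvd_or_dvd h1).resolve_left hc₂, (hP₂.dvd_or_dvd h2).resolve_left hc₂⟩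
  · rintro ⟨x, y⟩ h h'
    have := hV₁ (r₁ + x.toNat) (r₂ + y.toNat)
    simpa [Int.toNat_add (hrect _ h).1, add_assoc] using this
  · rintro ⟨x, y⟩ h h'
    have := hV₂ (r₁ + x.toNat) (r₂ + y.toNat)
    simpa [Int.toNat_add (hrect _ h).2, add_assoc] using this
  · intro n
    have e1 : c * a * (n : ℤ) + c * b = c * (a * n + b) := by ring
    have e2 : j * (n : ℤ) + i = (p₁ : ℤ) ^ r₁ * (p₂ : ℤ) ^ r₂ * (a * n + b) := by
      rw [hj, hi, ha, hb]; ring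
    have hx : ∀ {p : ℕ} {t : ℕ}, nu p (c * (a * (n : ℤ) + b)) ≤ t → a * (n : ℤ) + b ≠ 0 :=
      fun h => right_ne_zero_of_mul (ne_zero_of_nu_le h)
    simp only [adicBoard, e1, e2]
    refine ⟨fun h => (hc _ (hx h)).2.2.1, fun h => (hc _ (hx h)).2.2.2, ?_⟩
    intro v₁ v₂ h1 h2 _
    have hx0 := hx h1.le
    rw [(hc _ hx0).1] at h1
    rw [(hc _ hx0).2.1] at h2
    rw [nu_pow_mul_pow_mul hp₁.out hp₂.out hne r₁ r₂ h1, mul_comm ((p₁ : ℤ) ^ r₁),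
      nu_pow_mul_pow_mul hp₂.out hp₁.out hne.symm r₂ r₁ h2]
    simp only [ENat.toNat_natCast, Int.toNat_natCast]

theorem obeysInitial_adicBoard {p₁ p₂ : ℕ} [hp₁ : Fact p₁.Prime] [hp₂ : Fact p₂.Prime]
    {W : Type*} (V : ℕ → ℕ → W) (N : ℕ) :
    ObeysInitial (decoratedInitial p₁ p₂ W) (adicBoard p₁ p₂ V N) := by
  intro n
  refine ⟨Equiv.refl _, fun m => ?_⟩
  rw [Equiv.refl_apply]
  by_cases hcop : Nat.Coprime (m : ZMod (p₁ * p₂)).val (p₁ * p₂)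
  · refine Or.inr ?_
    have : NeZero (p₁ * p₂) := ⟨mul_ne_zero hp₁.out.ne_zero hp₂.out.ne_zero⟩
    have key : ∀ {p : ℕ} [hp : Fact p.Prime], p ∣ p₁ * p₂ →
        (lastDigit p m : ZMod p) = ((m : ZMod (p₁ * p₂)).val : ZMod p) := by
      intro p hp hd
      have hval : (((m : ZMod (p₁ * p₂)).val : ℕ) : ZMod p) = (m : ZMod p) := by
        rw [ZMod.natCast_val, ZMod.cast_intCast hd]
      rw [hval, lastDigit_of_not_dvd]
      rw [← intCast_ne_zero_iff, ← hval, Ne, ZMod.natCast_eq_zero_iff]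
      exact (hp.out.coprime_iff_not_dvd).1 (hcop.coprime_dvd_right hd).symm
    exact ⟨key (dvd_mul_right _ _), key (dvd_mul_left _ _)⟩
  · exact Or.inl hcop

theorem sudokuSolvable_of_solvableOn_quadrant {p₁ p₂ : ℕ} [hp₁ : Fact p₁.Prime]
    [hp₂ : Fact p₂.Prime] (hne : p₁ ≠ p₂) {W : Type*} {R : DominoSet W}
    (h : R.SolvableOn quadrant) :
    SudokuSolvable (decoratedRule p₁ p₂ R) (decoratedInitial p₁ p₂ W) := by
  obtain ⟨T, hT₁, hT₂⟩ := h
  have hmem : ∀ r₁ r₂ : ℕ, ((r₁ : ℤ), (r₂ : ℤ)) ∈ quadrant := fun r₁ r₂ =>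
    ⟨Int.natCast_nonneg _, Int.natCast_nonneg _⟩
  refine ⟨_, isSudokuSolution_adicBoard hne (V := fun r₁ r₂ => T ⟨_, hmem r₁ r₂⟩) ?_ ?_,
    obeysInitial_adicBoard _ _⟩
  · intro r₁ r₂
    have h' : ((r₁ : ℤ), (r₂ : ℤ)) + (1, 0) ∈ quadrant := by
      simpa using hmem (r₁ + 1) r₂
    convert hT₁ _ (hmem r₁ r₂) h' using 4
    simp
  · intro r₁ r₂
    have h' : ((r₁ : ℤ), (r₂ : ℤ)) + (0, 1) ∈ quadrant := by
      simpa using hmem r₁ (r₂ + 1)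
    convert hT₂ _ (hmem r₁ r₂) h' using 4
    simp

/-! ### Primitive recursive predicates -/

section Primrec

variable {α : Type*} [Primcodable α]

theorem primrecPred_const (q : Prop) : PrimrecPred fun _ : α => q := by
  by_cases hq : q
  · exact ((Primrec.eq.comp (Primrec.const 0) (Primrec.const 0)) :
      PrimrecPred fun _ : α => (0 : ℕ) = 0).of_eq fun _ => by simp [hq]
  · exact ((Primrec.eq.comp (Primrec.const 0) (Primrec.const 1)) :
      PrimrecPred fun _ : α => (0 : ℕ) = 1).of_eq fun _ => by simp [hq]

theorem primrecPred_finite_exists {ι : Type*} [Finite ι] {P : ι → α → Prop}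
    (h : ∀ i, PrimrecPred (P i)) : PrimrecPred fun a => ∃ i, P i a := by
  classical
  have := Fintype.ofFinite ι
  have key : ∀ s : Finset ι, PrimrecPred fun a => ∃ i ∈ s, P i a := by
    intro s
    induction s using Finset.induction_on with
    | empty => exact (primrecPred_const False).of_eq fun a => by simp
    | insert i s _ ih => exact ((h i).or ih).of_eq fun a => by simp
  exact (key Finset.univ).of_eq fun a => by simp

theorem primrecPred_finite_forall {ι : Type*} [Finite ι] {P : ι → α → Prop}
    (h : ∀ i, PrimrecPred (P i)) : PrimrecPred fun a => ∀ i, P i a :=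
  (primrecPred_finite_exists fun i => (h i).not).not.of_eq fun a => by simp

theorem primrecPred_imp (q : Prop) {P : α → Prop} (h : PrimrecPred P) :
    PrimrecPred fun a => q → P a := by
  by_cases hq : q
  · exact h.of_eq fun a => by simp [hq]
  · exact (primrecPred_const True).of_eq fun a => by simp [hq]

theorem primrecPred_mem_list {β : Type*} [Primcodable β] {f : α → β} {L : α → List β}
    (hf : Primrec f) (hL : Primrec L) : PrimrecPred fun a => f a ∈ L a :=
  ((Primrec.eq (α := β)).exists_mem_list.comp hL hf).of_eq fun a => by simp

/-- The lists of length `n` with entries less than `d`. -/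
def tuples : ℕ → ℕ → List (List ℕ)
  | 0, _ => [[]]
  | n + 1, d => (List.range d).flatMap fun x => (tuples n d).map fun l => x :: l

theorem mem_tuples {n d : ℕ} {l : List ℕ} :
    l ∈ tuples n d ↔ ∃ h : Fin n → Fin d, l = List.ofFn fun i => (h i : ℕ) := by
  induction n generalizing l with
  | zero => simp [tuples]
  | succ n ih =>
    simp only [tuples, List.mem_flatMap, List.mem_range, List.mem_map]
    constructor
    · rintro ⟨x, hx, l', hl', rfl⟩
      obtain ⟨h, rfl⟩ := ih.1 hl'
      exact ⟨Fin.cons ⟨x, hx⟩ h, by simp [List.ofFn_succ]⟩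
    · rintro ⟨h, rfl⟩
      exact ⟨h 0, (h 0).2, _, ih.2 ⟨fun i => h i.succ, rfl⟩, by simp [List.ofFn_succ]⟩

theorem primrec_tuples (n : ℕ) : Primrec (tuples n) := by
  induction n with
  | zero => exact Primrec.const [[]]
  | succ n ih =>
    refine Primrec.list_flatMap Primrec.list_range ?_
    exact Primrec.list_map (ih.comp Primrec.fst)
      (Primrec.list_cons.comp₂ (Primrec.snd.comp₂ Primrec₂.left) Primrec₂.right)

open Classical in
theorem primrec_filter_param {β : Type*} [Primcodable β] {L : α → List β} {P : α × β → Prop}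
    (hL : Primrec L) (hP : PrimrecPred P) :
    ∃ f : α → List β, Primrec f ∧ ∀ a b, b ∈ f a ↔ b ∈ L a ∧ P (a, b) := by
  refine ⟨fun a => (L a).flatMap fun b => if P (a, b) then [b] else [], ?_, fun a b => ?_⟩
  · refine Primrec.list_flatMap hL ?_
    exact Primrec.ite hP (Primrec.list_cons.comp Primrec.snd (Primrec.const [])) (Primrec.const [])
  · simp only [List.mem_flatMap]
    constructor
    · rintro ⟨x, hx, h⟩
      split_ifs at h with hPx
      · rw [List.mem_singleton] at h
        subst h
        exact ⟨hx, hPx⟩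
      · simp at h
    · rintro ⟨h1, h2⟩
      exact ⟨b, h1, by simp [h2]⟩

end Primrec

/-! ### Computing the decorated Sudoku -/

theorem tIndex_le_one (p : ℕ) (a : ℤ) : tIndex p a ≤ 1 := by
  unfold tIndex
  split_ifs <;> simp

theorem mem_tRect_iff {p₁ p₂ : ℕ} {a : ℤ} {x y : ℕ} :
    ((x : ℤ), (y : ℤ)) ∈ tRect p₁ p₂ a ↔ x ≤ tIndex p₁ a ∧ y ≤ tIndex p₂ a := by
  simp [tRect, Prod.le_def]

section Code

variable (p₁ p₂ : ℕ) [hp₁ : Fact p₁.Prime] [hp₂ : Fact p₂.Prime]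

/-- What the decorated rule demands of a line, apart from the domino set: the rows and the columns
of the square `{0, 1}²` in which there is a domino relation, and, for each cell of the line, the
admissible pairs of digits and the places of the square whose pip has to be copied. -/
abbrev LinePattern : Type :=
  Set (Fin 2) × Set (Fin 2) × (Fin (p₁ ^ 2 * p₂ ^ 2) → Set ((ZMod p₁)ˣ × (ZMod p₂)ˣ)) ×
    (Fin (p₁ ^ 2 * p₂ ^ 2) → Set (Fin 2 × Fin 2))

/-- The pattern of the affine form `a n + b`. -/
noncomputable def linePattern (a b : ℤ) : LinePattern p₁ p₂ :=
  ({y | 1 ≤ tIndex p₁ a ∧ (y : ℕ) ≤ tIndex p₂ a}, {x | (x : ℕ) ≤ tIndex p₁ a ∧ 1 ≤ tIndex p₂ a},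
    fun n => {u | (nu p₁ (a * (n : ℤ) + b) ≤ (tIndex p₁ a : ℕ∞) →
        u.1 = lastDigit p₁ (a * (n : ℤ) + b)) ∧
      (nu p₂ (a * (n : ℤ) + b) ≤ (tIndex p₂ a : ℕ∞) → u.2 = lastDigit p₂ (a * (n : ℤ) + b))},
    fun n => {s | nu p₁ (a * (n : ℤ) + b) = ((s.1 : ℕ) : ℕ∞) ∧
      nu p₂ (a * (n : ℤ) + b) = ((s.2 : ℕ) : ℕ∞) ∧
      (s.1 : ℕ) ≤ tIndex p₁ a ∧ (s.2 : ℕ) ≤ tIndex p₂ a})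

/-- The patterns of the non-degenerate affine forms. -/
def linePatterns : Set (LinePattern p₁ p₂) :=
  {π | ∃ a b : ℤ, NonDegenerate p₁ a b ∧ NonDegenerate p₂ a b ∧ π = linePattern p₁ p₂ a b}

variable {p₁ p₂} in
/-- The line `g`, decorated by means of the pips `T` on the square, fits the pattern `π`. -/
def FitsPattern {W : Type*} (R : DominoSet W) (π : LinePattern p₁ p₂) (T : Fin 2 × Fin 2 → W)
    (g : Fin (p₁ ^ 2 * p₂ ^ 2) → DecoratedDigit p₁ p₂ W) : Prop :=
  (∀ y ∈ π.1, (T (0, y), T (1, y)) ∈ R.R₁) ∧ (∀ x ∈ π.2.1, (T (x, 0), T (x, 1)) ∈ R.R₂) ∧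
    ∀ n, ((g n).1, (g n).2.1) ∈ π.2.2.1 n ∧ ∀ s ∈ π.2.2.2 n, (g n).2.2 = T s

theorem mem_decoratedRule_iff {W : Type*} [Nonempty W] (R : DominoSet W)
    (g : Fin (p₁ ^ 2 * p₂ ^ 2) → DecoratedDigit p₁ p₂ W) :
    g ∈ decoratedRule p₁ p₂ R ↔ ∃ π ∈ linePatterns p₁ p₂, ∃ T, FitsPattern R π T g := by
  classical
  constructor
  · rintro ⟨a, b, hab₁, hab₂, T, ⟨hT₁, hT₂⟩, hg⟩
    refine ⟨_, ⟨a, b, hab₁, hab₂, rfl⟩, fun s => if h : (((s.1 : ℕ) : ℤ), ((s.2 : ℕ) : ℤ)) ∈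
      tRect p₁ p₂ a then T ⟨_, h⟩ else Classical.arbitrary W, ?_, ?_, ?_⟩
    · rintro y ⟨h1, h2⟩
      have m0 : (((0 : ℕ) : ℤ), ((y : ℕ) : ℤ)) ∈ tRect p₁ p₂ a := mem_tRect_iff.2 ⟨by omega, h2⟩
      have m1 : (((1 : ℕ) : ℤ), ((y : ℕ) : ℤ)) ∈ tRect p₁ p₂ a := mem_tRect_iff.2 ⟨h1, h2⟩
      have e1 : (((0 : ℕ) : ℤ), ((y : ℕ) : ℤ)) + (1, 0) = (((1 : ℕ) : ℤ), ((y : ℕ) : ℤ)) := by simp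
      have := hT₁ _ m0 (by rw [e1]; exact m1)
      simp only [e1] at this
      dsimp only [Fin.val_zero, Fin.val_one]
      rw [dif_pos m0, dif_pos m1]
      exact this
    · rintro x ⟨h1, h2⟩
      have m0 : (((x : ℕ) : ℤ), ((0 : ℕ) : ℤ)) ∈ tRect p₁ p₂ a := mem_tRect_iff.2 ⟨h1, by omega⟩
      have m1 : (((x : ℕ) : ℤ), ((1 : ℕ) : ℤ)) ∈ tRect p₁ p₂ a := mem_tRect_iff.2 ⟨h1, h2⟩
      have e1 : (((x : ℕ) : ℤ), ((0 : ℕ) : ℤ)) + (0, 1) = (((x : ℕ) : ℤ), ((1 : ℕ) : ℤ)) := by simp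
      have := hT₂ _ m0 (by rw [e1]; exact m1)
      simp only [e1] at this
      dsimp only [Fin.val_zero, Fin.val_one]
      rw [dif_pos m0, dif_pos m1]
      exact this
    · intro n
      refine ⟨⟨(hg n).1, (hg n).2.1⟩, ?_⟩
      rintro s ⟨h1, h2, h3, h4⟩
      have m := mem_tRect_iff.2 ⟨h3, h4⟩
      dsimp only
      rw [dif_pos m]
      exact (hg n).2.2 _ _ h1 h2 m
  · rintro ⟨_, ⟨a, b, hab₁, hab₂, rfl⟩, T, hT₁, hT₂, hg⟩
    have hle₁ := tIndex_le_one p₁ a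
    have hle₂ := tIndex_le_one p₂ a
    refine ⟨a, b, hab₁, hab₂, fun s => T (Fin.ofNat 2 s.1.1.toNat, Fin.ofNat 2 s.1.2.toNat),
      ⟨?_, ?_⟩, ?_⟩
    · rintro ⟨x, y⟩ h h'
      obtain ⟨x, rfl⟩ := Int.eq_ofNat_of_zero_le (show 0 ≤ x from h.1.1)
      obtain ⟨y, rfl⟩ := Int.eq_ofNat_of_zero_le (show 0 ≤ y from h.1.2)
      have e : ((x : ℤ), (y : ℤ)) + (1, 0) = (((x + 1 : ℕ) : ℤ), (y : ℤ)) := by simp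
      rw [e, mem_tRect_iff] at h'
      obtain rfl : x = 0 := by omega
      have := hT₁ (Fin.ofNat 2 y) ⟨by omega, by
        simp only [Fin.ofNat, Nat.mod_eq_of_lt (show y < 2 by omega)]; exact h'.2⟩
      simpa using this
    · rintro ⟨x, y⟩ h h'
      obtain ⟨x, rfl⟩ := Int.eq_ofNat_of_zero_le (show 0 ≤ x from h.1.1)
      obtain ⟨y, rfl⟩ := Int.eq_ofNat_of_zero_le (show 0 ≤ y from h.1.2)
      have e : ((x : ℤ), (y : ℤ)) + (0, 1) = ((x : ℤ), ((y + 1 : ℕ) : ℤ)) := by simp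
      rw [e, mem_tRect_iff] at h'
      obtain rfl : y = 0 := by omega
      have := hT₂ (Fin.ofNat 2 x) ⟨by
        simp only [Fin.ofNat, Nat.mod_eq_of_lt (show x < 2 by omega)]; exact h'.1, by omega⟩
      simpa using this
    · intro n
      refine ⟨(hg n).1.1, (hg n).1.2, ?_⟩
      intro v₁ v₂ h1 h2 h
      obtain ⟨h3, h4⟩ := mem_tRect_iff.1 h
      refine (hg n).2 (Fin.ofNat 2 _, Fin.ofNat 2 _) ?_
      simp only [Fin.ofNat, Int.toNat_natCast, Nat.mod_eq_of_lt (show v₁ < 2 by omega),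
        Nat.mod_eq_of_lt (show v₂ < 2 by omega)]
      exact ⟨h1, h2, h3, h4⟩

/-- A labelling of the pairs of non-zero residues. -/
noncomputable def unitsLabel :
    (ZMod p₁)ˣ × (ZMod p₂)ˣ ≃ Fin (Fintype.card ((ZMod p₁)ˣ × (ZMod p₂)ˣ)) :=
  Fintype.equivFin _

variable {p₁ p₂} in
/-- The labelling of the digits of the decorated Sudoku derived from a labelling of the pips: the
pip is the quotient, and the pair of residues the remainder, modulo the number of such pairs. -/
noncomputable def digitLabel {W : Type*} {k : ℕ} (e : W ≃ Fin k) :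
    DecoratedDigit p₁ p₂ W ≃ Fin (k * Fintype.card ((ZMod p₁)ˣ × (ZMod p₂)ˣ)) :=
  (Equiv.prodAssoc _ _ _).symm.trans <| (Equiv.prodComm _ _).trans <|
    (e.prodCongr (unitsLabel p₁ p₂)).trans finProdFinEquiv

variable {p₁ p₂} in
theorem digitLabel_apply {W : Type*} {k : ℕ} (e : W ≃ Fin k) (g : DecoratedDigit p₁ p₂ W) :
    (digitLabel e g : ℕ) = (unitsLabel p₁ p₂ (g.1, g.2.1) : ℕ) +
      Fintype.card ((ZMod p₁)ˣ × (ZMod p₂)ˣ) * (e g.2.2 : ℕ) := rfl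

variable {p₁ p₂} in
/-- The condition `FitsPattern`, in terms of the labels of the pips and of the digits. -/
def CodeFitsPattern (π : LinePattern p₁ p₂) (c : DominoCode) (τ l : List ℕ) : Prop :=
  (∀ y, y ∈ π.1 → (τ.getD (finProdFinEquiv ((0, y) : Fin 2 × Fin 2)) 0,
    τ.getD (finProdFinEquiv ((1, y) : Fin 2 × Fin 2)) 0) ∈ c.2.1) ∧
  (∀ x, x ∈ π.2.1 → (τ.getD (finProdFinEquiv ((x, 0) : Fin 2 × Fin 2)) 0,
    τ.getD (finProdFinEquiv ((x, 1) : Fin 2 × Fin 2)) 0) ∈ c.2.2) ∧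
  ∀ n : Fin (p₁ ^ 2 * p₂ ^ 2),
    (∃ u, u ∈ π.2.2.1 n ∧
      l.getD n 0 % Fintype.card ((ZMod p₁)ˣ × (ZMod p₂)ˣ) = (unitsLabel p₁ p₂ u : ℕ)) ∧
    ∀ s, s ∈ π.2.2.2 n → l.getD n 0 / Fintype.card ((ZMod p₁)ˣ × (ZMod p₂)ˣ) =
      τ.getD (finProdFinEquiv (s : Fin 2 × Fin 2)) 0

theorem List.getD_ofFn_val {n : ℕ} (f : Fin n → ℕ) (i : Fin n) : (List.ofFn f).getD i 0 = f i := by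
  simp [List.getD_eq_getElem?_getD]

variable {p₁ p₂} in
theorem codeFitsPattern_iff {W : Type*} {R : DominoSet W} {k : ℕ} {e : W ≃ Fin k}
    {L₁ L₂ : List (ℕ × ℕ)} (hL₁ : ∀ x, x ∈ L₁ ↔ ∃ y ∈ R.R₁, x = ((e y.1 : ℕ), (e y.2 : ℕ)))
    (hL₂ : ∀ x, x ∈ L₂ ↔ ∃ y ∈ R.R₂, x = ((e y.1 : ℕ), (e y.2 : ℕ))) (π : LinePattern p₁ p₂)
    (T : Fin 2 × Fin 2 → W) (g : Fin (p₁ ^ 2 * p₂ ^ 2) → DecoratedDigit p₁ p₂ W) :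
    CodeFitsPattern π (k, L₁, L₂) (List.ofFn fun i => (e (T (finProdFinEquiv.symm i)) : ℕ))
      (List.ofFn fun n => (digitLabel e (g n) : ℕ)) ↔ FitsPattern R π T g := by
  have hM : 0 < Fintype.card ((ZMod p₁)ˣ × (ZMod p₂)ˣ) := Fintype.card_pos
  have hinj : ∀ {x y : W}, ((e x : ℕ) = (e y : ℕ)) ↔ x = y := fun {x y} => by
    rw [← Fin.ext_iff, e.apply_eq_iff_eq]
  have hmem : ∀ {L : List (ℕ × ℕ)} {S : Set (W × W)}
      (_ : ∀ x, x ∈ L ↔ ∃ y ∈ S, x = ((e y.1 : ℕ), (e y.2 : ℕ))) (v w : W),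
      ((e v : ℕ), (e w : ℕ)) ∈ L ↔ (v, w) ∈ S := by
    intro L S h v w
    rw [h]
    constructor
    · rintro ⟨⟨v', w'⟩, hy, heq⟩
      rw [Prod.mk.injEq, hinj, hinj] at heq
      rw [heq.1, heq.2]
      exact hy
    · intro h
      exact ⟨_, h, rfl⟩
  have hmod : ∀ d : DecoratedDigit p₁ p₂ W,
      (digitLabel e d : ℕ) % Fintype.card ((ZMod p₁)ˣ × (ZMod p₂)ˣ) =
        (unitsLabel p₁ p₂ (d.1, d.2.1) : ℕ) := fun d => by
    rw [digitLabel_apply, Nat.add_mul_mod_self_left, Nat.mod_eq_of_lt (Fin.is_lt _)]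
  have hdiv : ∀ d : DecoratedDigit p₁ p₂ W,
      (digitLabel e d : ℕ) / Fintype.card ((ZMod p₁)ˣ × (ZMod p₂)ˣ) = (e d.2.2 : ℕ) := fun d => by
    rw [digitLabel_apply, Nat.add_mul_div_left _ _ hM, Nat.div_eq_of_lt (Fin.is_lt _), zero_add]
  unfold CodeFitsPattern FitsPattern
  simp only [List.getD_ofFn_val, Equiv.symm_apply_apply, hmem hL₁, hmem hL₂, hmod, hdiv, hinj]
  refine and_congr Iff.rfl (and_congr Iff.rfl (forall_congr' fun n => and_congr ?_ Iff.rfl))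
  constructor
  · rintro ⟨u, hu, heq⟩
    rw [← Fin.ext_iff, (unitsLabel p₁ p₂).apply_eq_iff_eq] at heq
    rwa [heq]
  · intro h
    exact ⟨_, h, rfl⟩

variable {p₁ p₂} in
theorem primrecPred_codeFitsPattern (π : LinePattern p₁ p₂) :
    PrimrecPred fun x : List ℕ × (DominoCode × List ℕ) => CodeFitsPattern π x.2.1 x.1 x.2.2 := by
  have hτ : ∀ i : ℕ, Primrec fun x : List ℕ × (DominoCode × List ℕ) => x.1.getD i 0 := fun i =>
    (Primrec.list_getD 0).comp Primrec.fst (Primrec.const i)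
  have hl : ∀ i : ℕ, Primrec fun x : List ℕ × (DominoCode × List ℕ) => x.2.2.getD i 0 := fun i =>
    (Primrec.list_getD 0).comp (Primrec.snd.comp Primrec.snd) (Primrec.const i)
  have hc : Primrec fun x : List ℕ × (DominoCode × List ℕ) => x.2.1.2 :=
    Primrec.snd.comp (Primrec.fst.comp Primrec.snd)
  refine PrimrecPred.and ?_ (PrimrecPred.and ?_ ?_)
  · exact primrecPred_finite_forall fun y => primrecPred_imp _
      (primrecPred_mem_list (Primrec.pair (hτ _) (hτ _)) (Primrec.fst.comp hc))
  · exact primrecPred_finite_forall fun y => primrecPred_imp _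
      (primrecPred_mem_list (Primrec.pair (hτ _) (hτ _)) (Primrec.snd.comp hc))
  · refine primrecPred_finite_forall fun n => PrimrecPred.and ?_ ?_
    · exact primrecPred_finite_exists fun u => (primrecPred_const _).and
        (Primrec.eq.comp (Primrec.nat_mod.comp (hl _) (Primrec.const _)) (Primrec.const _))
    · exact primrecPred_finite_forall fun s => primrecPred_imp _
        (Primrec.eq.comp (Primrec.nat_div.comp (hl _) (Primrec.const _)) (hτ _))

/-- The list of the elements of the decorated rule can be computed: there are finitely many
patterns, and for each of them the condition on a line is a decidable one. -/
theorem exists_primrec_rule : ∃ f : DominoCode → List (List ℕ), Primrec f ∧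
    ∀ (W : Type*) [Nonempty W] (R : DominoSet W) (k : ℕ) (e : W ≃ Fin k) (L₁ L₂ : List (ℕ × ℕ)),
      (∀ x, x ∈ L₁ ↔ ∃ y ∈ R.R₁, x = ((e y.1 : ℕ), (e y.2 : ℕ))) →
      (∀ x, x ∈ L₂ ↔ ∃ y ∈ R.R₂, x = ((e y.1 : ℕ), (e y.2 : ℕ))) →
      ∀ l, l ∈ f (k, L₁, L₂) ↔ ∃ g ∈ decoratedRule p₁ p₂ R,
        l = List.ofFn (fun n => (digitLabel e (g n) : ℕ)) := by
  have hpred : PrimrecPred fun x : DominoCode × List ℕ => ∃ τ ∈ tuples (2 * 2) x.1.1,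
      ∃ π : linePatterns p₁ p₂, CodeFitsPattern π.1 x.1 τ x.2 :=
    (PrimrecRel.exists_mem_list (R := fun (τ : List ℕ) (x : DominoCode × List ℕ) =>
      ∃ π : linePatterns p₁ p₂, CodeFitsPattern π.1 x.1 τ x.2)
      (primrecPred_finite_exists fun π => primrecPred_codeFitsPattern π.1)).comp
      ((primrec_tuples _).comp (Primrec.fst.comp Primrec.fst)) Primrec.id
  obtain ⟨f, hf, hmem⟩ := primrec_filter_param
    (L := fun c : DominoCode =>
      tuples (p₁ ^ 2 * p₂ ^ 2) (c.1 * Fintype.card ((ZMod p₁)ˣ × (ZMod p₂)ˣ)))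
    ((primrec_tuples _).comp (Primrec.nat_mul.comp Primrec.fst (Primrec.const _))) hpred
  refine ⟨f, hf, fun W _ R k e L₁ L₂ hL₁ hL₂ l => ?_⟩
  rw [hmem]
  constructor
  · rintro ⟨hl, τ, hτ, ⟨π, hπ⟩, hfit⟩
    obtain ⟨g, rfl⟩ := mem_tuples.1 hl
    obtain ⟨t, rfl⟩ := mem_tuples.1 hτ
    have := codeFitsPattern_iff hL₁ hL₂ π (fun s => e.symm (t (finProdFinEquiv s)))
      (fun n => (digitLabel e).symm (g n))
    simp only [Equiv.apply_symm_apply] at this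
    exact ⟨fun n => (digitLabel e).symm (g n),
      (mem_decoratedRule_iff p₁ p₂ R _).2 ⟨π, hπ, _, this.1 hfit⟩, by simp⟩
  · rintro ⟨g, hg, rfl⟩
    obtain ⟨π, hπ, T, hT⟩ := (mem_decoratedRule_iff p₁ p₂ R _).1 hg
    exact ⟨mem_tuples.2 ⟨fun n => digitLabel e (g n), rfl⟩, _,
      mem_tuples.2 ⟨fun i => e (T (finProdFinEquiv.symm i)), rfl⟩, ⟨π, hπ⟩,
      (codeFitsPattern_iff hL₁ hL₂ π T g).2 hT⟩

/-- The list of the elements of the initial condition can be computed. -/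
theorem exists_primrec_initial : ∃ f : DominoCode → List (ℕ × ℕ), Primrec f ∧
    ∀ (W : Type*) (k : ℕ) (e : W ≃ Fin k) (L : List (ℕ × ℕ) × List (ℕ × ℕ)) (x : ℕ × ℕ),
      x ∈ f (k, L) ↔ ∃ y ∈ decoratedInitial p₁ p₂ W, x = (y.1.val, (digitLabel e y.2 : ℕ)) := by
  classical
  have : NeZero (p₁ * p₂) := ⟨mul_ne_zero hp₁.out.ne_zero hp₂.out.ne_zero⟩
  set S : Finset (ZMod (p₁ * p₂) × DecoratedDigit p₁ p₂ Unit) :=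
    (Set.toFinite (decoratedInitial p₁ p₂ Unit)).toFinset with hS
  refine ⟨fun c => (List.range c.1).flatMap fun w => (S.toList.map fun z =>
    (z.1.val, (unitsLabel p₁ p₂ (z.2.1, z.2.2.1) : ℕ))).map fun z =>
      (z.1, z.2 + Fintype.card ((ZMod p₁)ˣ × (ZMod p₂)ˣ) * w), ?_, ?_⟩
  · refine Primrec.list_flatMap (Primrec.list_range.comp Primrec.fst) ?_
    refine Primrec.list_map (Primrec.const _) ?_
    exact Primrec.pair (Primrec.fst.comp Primrec.snd)
      (Primrec.nat_add.comp (Primrec.snd.comp Primrec.snd)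
        (Primrec.nat_mul.comp (Primrec.const _) (Primrec.snd.comp Primrec.fst)))
  · intro W k e L x
    simp only [List.mem_flatMap, List.mem_range, List.mem_map, Finset.mem_toList, hS,
      Set.Finite.mem_toFinset]
    constructor
    · rintro ⟨w, hw, _, ⟨⟨y, u₁, u₂, _⟩, hy, rfl⟩, rfl⟩
      refine ⟨(y, u₁, u₂, e.symm ⟨w, hw⟩), hy, ?_⟩
      rw [digitLabel_apply]
      simp
    · rintro ⟨⟨y, u₁, u₂, w⟩, hy, rfl⟩
      exact ⟨e w, (e w).2, _, ⟨(y, u₁, u₂, ()), hy, rfl⟩, rfl⟩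

theorem exists_computable_code : ∃ f : DominoCode → SudokuCode, Computable f ∧
    ∀ (W : Type*) [Finite W] [Nonempty W] (R : DominoSet W) (c : DominoCode),
      DescribesDomino c R →
        DescribesSudoku (f c) (decoratedRule p₁ p₂ R) (decoratedInitial p₁ p₂ W) := by
  obtain ⟨f, hf, hrule⟩ := exists_primrec_rule p₁ p₂
  obtain ⟨g, hg, hinitial⟩ := exists_primrec_initial p₁ p₂
  refine ⟨fun c => (p₁ ^ 2 * p₂ ^ 2, c.1 * Fintype.card ((ZMod p₁)ˣ × (ZMod p₂)ˣ), f c, p₁ * p₂,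
    g c), ?_, ?_⟩
  · exact (Primrec.pair (Primrec.const _) (Primrec.pair
      (Primrec.nat_mul.comp Primrec.fst (Primrec.const _))
      (Primrec.pair hf (Primrec.pair (Primrec.const _) hg)))).to_comp
  · rintro W _ _ R _ ⟨k, e, L₁, L₂, rfl, hL₁, hL₂⟩
    exact ⟨_, digitLabel e, _, _, rfl, hrule W R k e L₁ L₂ hL₁ hL₂, hinitial W k e _⟩

end Code

theorem mainTheorem3 (p₁ p₂ : ℕ) [Fact p₁.Prime] [Fact p₂.Prime] (hne : p₁ ≠ p₂)
    (h₁ : 48 < p₁) (h₂ : 48 < p₂) :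
    (∃ f : DominoCode → SudokuCode, Computable f ∧
      ∀ (W : Type*) [Finite W] [Nonempty W] (R : DominoSet W) (c : DominoCode),
        DescribesDomino c R →
          DescribesSudoku (f c) (decoratedRule p₁ p₂ R) (decoratedInitial p₁ p₂ W)) ∧
    ∀ (W : Type*) [Finite W] [Nonempty W] (R : DominoSet W),
      R.SolvableOn quadrant ↔
        SudokuSolvable (decoratedRule p₁ p₂ R) (decoratedInitial p₁ p₂ W) :=
  ⟨exists_computable_code p₁ p₂, fun _ _ _ _ => ⟨sudokuSolvable_of_solvableOn_quadrant hne,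
    solvableOn_quadrant_of_sudokuSolvable hne h₁ h₂⟩⟩
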